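/- Let $d,t\ge 2$ be fixed integers, and let the broom $B_{d,t}$ be the graph consisting of a path on $t$ vertices together with $d$ additional vertices of degree one, all adjacent to the same endpoint of the path. A graph is $B_{d,t}$-free if it has no induced subgraph isomorphic to $B_{d,t}$. There is a deterministic algorithm (depending on $d$ and $t$) that, given a finite simple graph $G$ with $n$ vertices that is $B_{d,t}$-free, finds an independent set $I$ of $G$ with $d\cdot|I|\ge\alpha(G)$, where $\alpha(G)$ is the maximum size of an independent set of $G$; its running time is $2^{O(n^{3/4}\log n)}$, that is, for some constant $C=C(d,t)$ it makes at most $2^{C n^{3/4}\log n}$ steps whenever $n\ge 2$. -/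

import Mathlib

/-! ### Brooms -/

/-- The `(d, t)`-broom `B_{d,t}`: an induced path on the `t` vertices `inl 0, …, inl (t-1)`
(consecutive ones adjacent) and `d` further vertices `inr j`, each of which is adjacent
to the endpoint `inl 0` of the path and to nothing else. -/
def broom (d t : ℕ) : SimpleGraph (Fin t ⊕ Fin d) where
  Adj
    | .inl i, .inl j => (SimpleGraph.pathGraph t).Adj i j
    | .inl i, .inr _ => i.val = 0
    | .inr _, .inl i => i.val = 0
    | .inr _, .inr _ => False
  symm := ⟨by
    rintro (i | i) (j | j) h
    · exact SimpleGraph.Adj.symm h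
    · exact h
    · exact h
    · exact h⟩
  loopless := ⟨by
    rintro (i | i) h
    · exact SimpleGraph.irrefl _ h
    · exact h⟩

/-! ### The machine model

A deterministic first-order functional language over binary trees ("pure Lisp"). A program is a
finite list of mutually recursive function bodies. The only operations are building a pair,
taking one of the two components of a pair, testing for `nil`, naming a value, and calling a
function; each costs one step. Values are immutable, so on a RAM or a pointer machine, with
trees represented by pointers to (shared) cells, each step is a constant number of operations;
the model is polynomially equivalent to Turing machines. -/

namespace TreeLang

/-- The data: binary trees. -/
inductive Val where
  | nil : Val
  | cons : Val → Val → Val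

/-- Head of a pair (and `nil` on `nil`). -/
def Val.head : Val → Val
  | .nil => .nil
  | .cons a _ => a

/-- Tail of a pair (and `nil` on `nil`). -/
def Val.tail : Val → Val
  | .nil => .nil
  | .cons _ b => b

/-- Expressions. Variables are de Bruijn indices: `var i` is the `i`-th most recently bound
variable. A function has exactly one parameter, which is `var 0` at the start of its body. -/
inductive Expr where
  | var : ℕ → Expr
  | nil : Expr
  | cons : Expr → Expr → Expr
  | head : Expr → Expr
  | tail : Expr → Expr
  /-- `cond c a b`: if `c` is a pair then `a`, and if `c` is `nil` then `b`. -/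
  | cond : Expr → Expr → Expr → Expr
  /-- `letIn a b`: bind the value of `a` as a new variable `0` in `b`. -/
  | letIn : Expr → Expr → Expr
  /-- `call f a`: apply the `f`-th function of the program to the value of `a`. -/
  | call : ℕ → Expr → Expr

/-- A program: the list of the bodies of its functions. Function `0` is the main function. -/
abbrev Program := List Expr

/-- `Eval P env e v k`: in program `P`, with the variables bound to the entries of `env`, the
(call-by-value) evaluation of the expression `e` terminates with value `v` after exactly
`k` steps. -/
inductive Eval (P : Program) : List Val → Expr → Val → ℕ → Prop
  | var {env : List Val} {i : ℕ} {v : Val} (h : env[i]? = some v) :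
      Eval P env (.var i) v 1
  | nil {env : List Val} : Eval P env .nil .nil 1
  | cons {env : List Val} {a b : Expr} {u v : Val} {k l : ℕ}
      (ha : Eval P env a u k) (hb : Eval P env b v l) :
      Eval P env (.cons a b) (.cons u v) (k + l + 1)
  | head {env : List Val} {a : Expr} {v : Val} {k : ℕ} (ha : Eval P env a v k) :
      Eval P env (.head a) v.head (k + 1)
  | tail {env : List Val} {a : Expr} {v : Val} {k : ℕ} (ha : Eval P env a v k) :
      Eval P env (.tail a) v.tail (k + 1)
  | condPair {env : List Val} {c a b : Expr} {x y v : Val} {k l : ℕ}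
      (hc : Eval P env c (.cons x y) k) (ha : Eval P env a v l) :
      Eval P env (.cond c a b) v (k + l + 1)
  | condNil {env : List Val} {c a b : Expr} {v : Val} {k l : ℕ}
      (hc : Eval P env c .nil k) (hb : Eval P env b v l) :
      Eval P env (.cond c a b) v (k + l + 1)
  | letIn {env : List Val} {a b : Expr} {u v : Val} {k l : ℕ}
      (ha : Eval P env a u k) (hb : Eval P (u :: env) b v l) :
      Eval P env (.letIn a b) v (k + l + 1)
  | call {env : List Val} {f : ℕ} {a body : Expr} {u v : Val} {k l : ℕ}
      (ha : Eval P env a u k) (hf : P[f]? = some body) (hb : Eval P [u] body v l) :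
      Eval P env (.call f a) v (k + l + 1)

/-- Evaluation is deterministic, in its result and in its number of steps. -/
theorem Eval.deterministic {P : Program} {env : List Val} {e : Expr} {v w : Val} {k l : ℕ}
    (h : Eval P env e v k) (h' : Eval P env e w l) : v = w ∧ k = l := by
  induction h generalizing w l with
  | var h => cases h' with | var h₂ => simp_all
  | nil => cases h'; simp
  | cons _ _ iha ihb => cases h' with | cons ha hb => have := iha ha; have := ihb hb; simp_all
  | head _ iha => cases h' with | head ha => have := iha ha; simp_all
  | tail _ iha => cases h' with | tail ha => have := iha ha; simp_all
  | condPair _ _ ihc iha =>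
    cases h' with
    | condPair hc ha => have := ihc hc; have := iha ha; simp_all
    | condNil hc _ => have := ihc hc; simp_all
  | condNil _ _ ihc iha =>
    cases h' with
    | condPair hc _ => have := ihc hc; simp_all
    | condNil hc ha => have := ihc hc; have := iha ha; simp_all
  | letIn _ _ iha ihb =>
    cases h' with
    | letIn ha hb => obtain ⟨rfl, rfl⟩ := iha ha; have := ihb hb; simp_all
  | call _ hf _ iha ihb =>
    cases h' with
    | call ha hf' hb =>
      obtain ⟨rfl, rfl⟩ := iha ha
      obtain rfl := Option.some.inj (hf.symm.trans hf')
      have := ihb hb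
      simp_all

/-- `Runs P x y k`: program `P`, started on the input `x`, halts with output `y` after exactly
`k` steps. -/
def Runs (P : Program) (x y : Val) (k : ℕ) : Prop :=
  Eval P [x] (.call 0 (.var 0)) y k

/-! ### Inputs and outputs -/

/-- The list `[v₁, …, vₘ]` as the tree `(v₁, (v₂, … (vₘ, nil)))`. -/
def Val.ofList : List Val → Val
  | [] => .nil
  | v :: vs => .cons v (Val.ofList vs)

/-- A truth value as a tree: false is `nil`, true is the pair `(nil, nil)`. -/
noncomputable def Val.ofProp (p : Prop) : Val :=
  open Classical in if p then .cons .nil .nil else .nil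

/-- The input: a graph with vertices `0, …, n-1`, given by its adjacency matrix (the list of its
`n` rows, each a list of `n` truth values). -/
noncomputable def encodeGraph {n : ℕ} (G : SimpleGraph (Fin n)) : Val :=
  Val.ofList ((List.finRange n).map fun i =>
    Val.ofList ((List.finRange n).map fun j => Val.ofProp (G.Adj i j)))

/-- The output: a set of vertices, given by its characteristic vector. -/
noncomputable def encodeSet {n : ℕ} (I : Finset (Fin n)) : Val :=
  Val.ofList ((List.finRange n).map fun i => Val.ofProp (i ∈ I))

end TreeLang

/-! The algorithm branches exactly until the graph has no large induced stars, and then local search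
is good enough. Put q = 2d+1+t.

Local search: if no vertex of X has 2d independent neighbours, an independent set I that allows
neither an addition nor an exchange of one vertex for two is a d-approximation
(`Indep.card_le_of_locally_maximal`). This is a double count between I and any independent A: all
but at most |I| vertices of A meet I at least twice, while each vertex of I is met at most 2d-1
times.

Separators: if a connected X does contain a star with 2d leaves, then at most q vertices have a
closed neighbourhood whose removal leaves only components with less than half of X
(`exists_separator`). This is a Gyárfás path argument. Otherwise a component with at least half of X
survives every removal, and walking into the surviving components extends an induced path, starting
at part of the star, until a broom appears.

Recursion: split a disconnected graph; branch on a vertex of degree above √n; if there is none, look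
for a separating q-tuple and branch on all of its closed neighbourhood, at most q(√n+1) vertices; if
there is no such tuple, the graph is free of stars with 2d leaves and local search applies.
Splitting and branching preserve the ratio d (`solves_split`, `solves_pivot`). The number of leaves
is bounded by `leafBound`, with one factor for each kind of step: splitting, branching on a large
degree, halving the components. Altogether it is (n+2)^{O(√n)}, so the exponent obtained is O(√n log
n), and n^{3/4} enters only by a final weakening.

Machine: each elementary step is shown to be `PolyTime` by closure rules that `fun_prop` applies,
and `RecTree.exists_eval` bounds the running time of the recursion by its number of leaves times a
polynomial. -/

/-! ### Linking programs -/

namespace TreeLang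

/-- Renumber the functions called in an expression, adding `m` to each index. -/
def Expr.shift (m : ℕ) : Expr → Expr
  | .var i => .var i
  | .nil => .nil
  | .cons a b => .cons (a.shift m) (b.shift m)
  | .head a => .head (a.shift m)
  | .tail a => .tail (a.shift m)
  | .cond c a b => .cond (c.shift m) (a.shift m) (b.shift m)
  | .letIn a b => .letIn (a.shift m) (b.shift m)
  | .call f a => .call (m + f) (a.shift m)

theorem Eval.append_program {P : Program} {env : List Val} {e : Expr} {v : Val} {k : ℕ}
    (h : Eval P env e v k) (Q : Program) : Eval (P ++ Q) env e v k := by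
  induction h with
  | var h => exact .var h
  | nil => exact .nil
  | cons _ _ iha ihb => exact .cons iha ihb
  | head _ iha => exact .head iha
  | tail _ iha => exact .tail iha
  | condPair _ _ ihc iha => exact .condPair ihc iha
  | condNil _ _ ihc ihb => exact .condNil ihc ihb
  | letIn _ _ iha ihb => exact .letIn iha ihb
  | call _ hf _ iha ihb =>
    obtain ⟨hlt, -⟩ := List.getElem?_eq_some_iff.1 hf
    exact .call iha (by rw [List.getElem?_append_left hlt, hf]) ihb

theorem Eval.shift {P : Program} {env : List Val} {e : Expr} {v : Val} {k : ℕ}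
    (h : Eval P env e v k) (Q : Program) :
    Eval (Q ++ P.map (Expr.shift Q.length)) env (e.shift Q.length) v k := by
  induction h with
  | var h => exact .var h
  | nil => exact .nil
  | cons _ _ iha ihb => exact .cons iha ihb
  | head _ iha => exact .head iha
  | tail _ iha => exact .tail iha
  | condPair _ _ ihc iha => exact .condPair ihc iha
  | condNil _ _ ihc ihb => exact .condNil ihc ihb
  | letIn _ _ iha ihb => exact .letIn iha ihb
  | call _ hf _ iha ihb =>
    refine .call iha ?_ ihb
    rw [List.getElem?_append_right (by omega)]
    simp [hf]

/-- An expression written for one input variable is reused under `letIn`, where the new value is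
variable 0 and older bindings lie behind it. -/
theorem Eval.append_env {P : Program} {env : List Val} {e : Expr} {v : Val} {k : ℕ}
    (h : Eval P env e v k) (env' : List Val) : Eval P (env ++ env') e v k := by
  induction h with
  | var h =>
    obtain ⟨hlt, -⟩ := List.getElem?_eq_some_iff.1 h
    exact .var (by rw [List.getElem?_append_left hlt, h])
  | nil => exact .nil
  | cons _ _ iha ihb => exact .cons iha ihb
  | head _ iha => exact .head iha
  | tail _ iha => exact .tail iha
  | condPair _ _ ihc iha => exact .condPair ihc iha
  | condNil _ _ ihc ihb => exact .condNil ihc ihb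
  | letIn _ _ iha ihb => exact .letIn iha ihb
  | call _ hf hb iha ihb => exact .call iha hf hb

theorem Eval.cons_env {P : Program} {x : Val} {e : Expr} {v : Val} {k : ℕ}
    (h : Eval P [x] e v k) (env : List Val) : Eval P (x :: env) e v k :=
  h.append_env env

/-- Two programs have a common extension. -/
theorem exists_link (P Q : Program) : ∃ (R : Program) (σ : Expr → Expr),
    (∀ {env e v k}, Eval P env e v k → Eval R env e v k) ∧
    (∀ {env e v k}, Eval Q env e v k → Eval R env (σ e) v k) :=
  ⟨P ++ Q.map (Expr.shift P.length), Expr.shift P.length,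
    fun h => h.append_program _, fun h => h.shift P⟩

/-! ### Encodings and sizes -/

/-- The number of nodes of a tree. -/
def Val.size : Val → ℕ
  | .nil => 1
  | .cons a b => a.size + b.size + 1

theorem Val.size_pos (v : Val) : 1 ≤ v.size := by
  cases v <;> simp [Val.size]

/-- A representation of the elements of a type by trees. -/
class Enc (α : Type) where
  enc : α → Val

/-- Naturals are represented in unary. -/
def Val.ofNat : ℕ → Val
  | 0 => .nil
  | n + 1 => .cons .nil (Val.ofNat n)

instance : Enc Unit := ⟨fun _ => .nil⟩
noncomputable instance : Enc Bool := ⟨fun b => Val.ofProp (b = true)⟩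
instance : Enc ℕ := ⟨Val.ofNat⟩
instance {α β : Type} [Enc α] [Enc β] : Enc (α × β) := ⟨fun p => .cons (Enc.enc p.1) (Enc.enc p.2)⟩
instance {α : Type} [Enc α] : Enc (List α) := ⟨fun l => Val.ofList (l.map Enc.enc)⟩

open Enc

variable {α β γ δ : Type} [Enc α] [Enc β] [Enc γ] [Enc δ]

theorem enc_cons (a : α) (l : List α) : enc (a :: l) = .cons (enc a) (enc l) := rfl
theorem enc_succ (n : ℕ) : enc (n + 1) = .cons .nil (enc n) := rfl
theorem enc_true : enc true = .cons .nil .nil := by simp [enc, Val.ofProp]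
theorem enc_false : enc false = .nil := by simp [enc, Val.ofProp]
theorem enc_replicate (n : ℕ) : enc (List.replicate n ()) = enc n := by
  induction n with
  | zero => rfl
  | succ n ih => rw [List.replicate_succ, enc_cons, enc_succ, ih]; rfl

/-- The size of the representation of `x`. -/
def sz (x : α) : ℕ := (enc x).size

theorem one_le_sz (x : α) : 1 ≤ sz x := Val.size_pos _
theorem sz_prod (a : α) (b : β) : sz (a, b) = sz a + sz b + 1 := rfl
theorem sz_nil : sz ([] : List α) = 1 := rfl
theorem sz_cons (a : α) (l : List α) : sz (a :: l) = sz a + sz l + 1 := rfl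
theorem sz_nat (n : ℕ) : sz n = 2 * n + 1 := by
  induction n with
  | zero => rfl
  | succ n ih => change 1 + sz n + 1 = _; omega
theorem sz_bool (b : Bool) : sz b ≤ 3 := by
  cases b <;> simp [sz, enc_true, enc_false, Val.size]

theorem length_lt_sz (l : List α) : l.length < sz l := by
  induction l with
  | nil => simp [sz_nil]
  | cons a l ih => rw [sz_cons, List.length_cons]; omega

theorem sz_eq_sum (l : List α) : sz l = 1 + (l.map fun a => sz a + 1).sum := by
  induction l with
  | nil => simp [sz_nil]
  | cons a l ih => rw [sz_cons, List.map_cons, List.sum_cons, ih]; omega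

theorem sz_le_of_mem {a : α} {l : List α} (h : a ∈ l) : sz a ≤ sz l := by
  induction l with
  | nil => simp at h
  | cons b l ih =>
    rw [sz_cons]
    rcases List.mem_cons.1 h with rfl | h
    · omega
    · have := ih h; omega

theorem sz_le_of_subperm {l l' : List α} (h : l.Subperm l') : sz l ≤ sz l' := by
  obtain ⟨l₁, h₁, h₂⟩ := h
  rw [sz_eq_sum, sz_eq_sum, ← (h₁.map _).sum_eq]
  have := (h₂.map fun a => sz a + 1).sum_le_sum (by simp)
  omega

theorem sz_le_of_forall {l : List α} {s : ℕ} (h : ∀ a ∈ l, sz a ≤ s) :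
    sz l ≤ 1 + l.length * (s + 1) := by
  induction l with
  | nil => simp [sz_nil]
  | cons a l ih =>
    have h₁ := h a (by simp)
    have h₂ := ih fun b hb => h b (by simp [hb])
    rw [sz_cons, List.length_cons, add_mul]; omega

/-! ### Polynomial bounds -/

/-- `f` is bounded by a polynomial in the size of its argument. -/
def PolyBdd (f : α → ℕ) : Prop := ∃ c : ℕ, ∀ x, f x ≤ (sz x + 2) ^ c

theorem PolyBdd.mono {f g : α → ℕ} (hg : PolyBdd g) (h : ∀ x, f x ≤ g x) : PolyBdd f :=
  let ⟨c, hc⟩ := hg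
  ⟨c, fun x => (h x).trans (hc x)⟩

theorem PolyBdd.size : PolyBdd (fun x : α => sz x) := ⟨1, fun x => by simp⟩

theorem PolyBdd.const (m : ℕ) : PolyBdd (fun _ : α => m) :=
  ⟨m, fun x => m.lt_two_pow_self.le.trans (Nat.pow_le_pow_left (by omega) _)⟩

theorem PolyBdd.mul {f g : α → ℕ} (hf : PolyBdd f) (hg : PolyBdd g) :
    PolyBdd fun x => f x * g x := by
  obtain ⟨a, ha⟩ := hf
  obtain ⟨b, hb⟩ := hg
  exact ⟨a + b, fun x => by rw [pow_add]; exact Nat.mul_le_mul (ha x) (hb x)⟩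

/-- The base `sz x + 2` is at least 2, so a sum costs just one more power. -/
theorem PolyBdd.add {f g : α → ℕ} (hf : PolyBdd f) (hg : PolyBdd g) :
    PolyBdd fun x => f x + g x := by
  obtain ⟨a, ha⟩ := hf
  obtain ⟨b, hb⟩ := hg
  refine ⟨a + b + 1, fun x => ?_⟩
  have h₁ : (sz x + 2) ^ a ≤ (sz x + 2) ^ (a + b) := Nat.pow_le_pow_right (by omega) (by omega)
  have h₂ : (sz x + 2) ^ b ≤ (sz x + 2) ^ (a + b) := Nat.pow_le_pow_right (by omega) (by omega)
  have h₃ := ha x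
  have h₄ := hb x
  calc f x + g x ≤ (sz x + 2) ^ (a + b) * 2 := by omega
    _ ≤ (sz x + 2) ^ (a + b + 1) := by rw [pow_succ]; exact Nat.mul_le_mul_left _ (by omega)

theorem PolyBdd.pow {f : α → ℕ} (hf : PolyBdd f) (m : ℕ) : PolyBdd fun x => f x ^ m := by
  obtain ⟨a, ha⟩ := hf
  exact ⟨a * m, fun x => by rw [pow_mul]; exact Nat.pow_le_pow_left (ha x) _⟩

theorem PolyBdd.comp {g : β → ℕ} {f : α → β} (hg : PolyBdd g) (hf : PolyBdd fun x => sz (f x)) :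
    PolyBdd fun x => g (f x) := by
  obtain ⟨c, hc⟩ := hg
  exact ((hf.add (.const 2)).pow c).mono fun x => hc (f x)

/-! ### Polynomial time -/

/-- `f` is computed by an expression of a program, in polynomial time and with a value of
polynomial size. -/
@[fun_prop]
def PolyTime (f : α → β) : Prop :=
  (PolyBdd fun x => sz (f x)) ∧ ∃ (P : Program) (e : Expr) (T : α → ℕ), PolyBdd T ∧
    ∀ x, ∃ k ≤ T x, Eval P [enc x] e (enc (f x)) k

theorem PolyTime.bdd {f : α → β} (hf : PolyTime f) : PolyBdd fun x => sz (f x) := hf.1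

/-- A change of type that leaves the tree unchanged costs one variable lookup: a list as a head-tail
pair, a number as a list of units. -/
theorem PolyTime.of_enc_eq {f : α → β} (h : ∀ x, enc (f x) = enc x) : PolyTime f :=
  ⟨PolyBdd.size.mono fun x => by rw [sz, h, sz], [], .var 0, _, .const 1,
    fun x => ⟨1, le_rfl, .var (by simp [h])⟩⟩

@[fun_prop]
theorem PolyTime.id : PolyTime fun x : α => x := .of_enc_eq fun _ => rfl

theorem exists_eval_const (v : Val) : ∃ (e : Expr) (k : ℕ), ∀ P env, Eval P env e v k := by
  induction v with
  | nil => exact ⟨.nil, 1, fun _ _ => .nil⟩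
  | cons a b iha ihb =>
    obtain ⟨e, k, he⟩ := iha
    obtain ⟨e', k', he'⟩ := ihb
    exact ⟨.cons e e', _, fun P env => .cons (he P env) (he' P env)⟩

@[fun_prop]
theorem PolyTime.const (b : β) : PolyTime fun _ : α => b := by
  obtain ⟨e, k, h⟩ := exists_eval_const (enc b)
  exact ⟨.const _, [], e, fun _ => k, .const k, fun x => ⟨k, le_rfl, h _ _⟩⟩

-- The size clause of `PolyTime` is essential here: by sharing, few steps can build an exponentially
-- large tree, so a time bound for `f` alone would not bound the argument passed to `g`.
@[fun_prop]
theorem PolyTime.comp {g : β → γ} {f : α → β} (hg : PolyTime g) (hf : PolyTime f) :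
    PolyTime fun x => g (f x) := by
  obtain ⟨hfs, P, e, T, hT, he⟩ := hf
  obtain ⟨hgs, P', e', T', hT', he'⟩ := hg
  obtain ⟨R, σ, h₁, h₂⟩ := exists_link P P'
  refine ⟨hgs.comp hfs, R, .letIn e (σ e'), _, (hT.add (hT'.comp hfs)).add (.const 1),
    fun x => ?_⟩
  obtain ⟨k, hk, hx⟩ := he x
  obtain ⟨k', hk', hx'⟩ := he' (f x)
  exact ⟨_, Nat.add_le_add_right (Nat.add_le_add hk hk') 1,
    .letIn (h₁ hx) ((h₂ hx').cons_env _)⟩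

@[fun_prop]
theorem PolyTime.pair {f : α → β} {g : α → γ} (hf : PolyTime f) (hg : PolyTime g) :
    PolyTime fun x => (f x, g x) := by
  obtain ⟨hfs, P, e, T, hT, he⟩ := hf
  obtain ⟨hgs, P', e', T', hT', he'⟩ := hg
  obtain ⟨R, σ, h₁, h₂⟩ := exists_link P P'
  refine ⟨(hfs.add hgs).add (.const 1), R, .cons e (σ e'), _, (hT.add hT').add (.const 1),
    fun x => ?_⟩
  obtain ⟨k, hk, hx⟩ := he x
  obtain ⟨k', hk', hx'⟩ := he' x
  exact ⟨_, Nat.add_le_add_right (Nat.add_le_add hk hk') 1, .cons (h₁ hx) (h₂ hx')⟩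

@[fun_prop]
theorem PolyTime.fst {f : α → β × γ} (hf : PolyTime f) : PolyTime fun x => (f x).1 := by
  refine PolyTime.comp (g := Prod.fst)
    ⟨?_, [], .head (.var 0), _, .const 2, fun x => ⟨_, le_rfl, ?_⟩⟩ hf
  · exact PolyBdd.size.mono fun x => by rw [← Prod.mk.eta (p := x), sz_prod]; simp; omega
  · exact Eval.head (v := enc x) (.var rfl)

@[fun_prop]
theorem PolyTime.snd {f : α → β × γ} (hf : PolyTime f) : PolyTime fun x => (f x).2 := by
  refine PolyTime.comp (g := Prod.snd)
    ⟨?_, [], .tail (.var 0), _, .const 2, fun x => ⟨_, le_rfl, ?_⟩⟩ hf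
  · exact PolyBdd.size.mono fun x => by rw [← Prod.mk.eta (p := x), sz_prod]; simp; omega
  · exact Eval.tail (v := enc x) (.var rfl)

@[fun_prop]
theorem PolyTime.ite {b : α → Bool} {f g : α → β} (hb : PolyTime b) (hf : PolyTime f)
    (hg : PolyTime g) : PolyTime fun x => if b x then f x else g x := by
  obtain ⟨-, P₀, e₀, T₀, hT₀, he₀⟩ := hb
  obtain ⟨hfs, P₁, e₁, T₁, hT₁, he₁⟩ := hf
  obtain ⟨hgs, P₂, e₂, T₂, hT₂, he₂⟩ := hg
  obtain ⟨R, σ, h₁, h₂⟩ := exists_link P₁ P₂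
  obtain ⟨R', τ, h₃, h₄⟩ := exists_link P₀ R
  refine ⟨(hfs.add hgs).mono fun x => ?_, R', .cond e₀ (τ e₁) (τ (σ e₂)), _,
    (hT₀.add (hT₁.add hT₂)).add (.const 1), fun x => ?_⟩
  · dsimp only; split_ifs <;> omega
  · obtain ⟨k, hk, hx⟩ := he₀ x
    obtain ⟨k₁, hk₁, hx₁⟩ := he₁ x
    obtain ⟨k₂, hk₂, hx₂⟩ := he₂ x
    cases hbx : b x
    · rw [hbx, enc_false] at hx
      refine ⟨k + k₂ + 1, by omega, ?_⟩
      beta_reduce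
      rw [hbx, if_neg (by simp)]
      exact .condNil (h₃ hx) (h₄ (h₂ hx₂))
    · rw [hbx, enc_true] at hx
      refine ⟨k + k₁ + 1, by omega, ?_⟩
      beta_reduce
      rw [hbx, if_pos rfl]
      exact .condPair (h₃ hx) (h₄ (h₁ hx₁))

/-- Structural recursion on a list, with a parameter. -/
theorem PolyTime.listRec {F : γ × List α → β} {b : γ → β} {s : γ × α × List α × β → β}
    (hb : PolyTime b) (hs : PolyTime s) (hF : PolyBdd fun x => sz (F x))
    (h_nil : ∀ c, F (c, []) = b c) (h_cons : ∀ c a l, F (c, a :: l) = s (c, a, l, F (c, l))) :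
    PolyTime F := by
  obtain ⟨-, P₁, e₁, T₁, ⟨c₁, hT₁⟩, he₁⟩ := hb
  obtain ⟨-, P₂, e₂, T₂, ⟨c₂, hT₂⟩, he₂⟩ := hs
  obtain ⟨R, σ, h₁, h₂⟩ := exists_link P₁ P₂
  have hF' := hF
  obtain ⟨c₃, hc₃⟩ := hF'
  set x : Expr := .var 0
  -- The new body is appended after `R`, so this is its own index and it can call itself.
  set self := R.length with hself
  set body : Expr := .cond (.tail x)
    (.letIn (.cons (.head x) (.cons (.head (.tail x)) (.cons (.tail (.tail x))
      (.call self (.cons (.head x) (.tail (.tail x))))))) (σ e₂))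
    (.letIn (.head x) e₁) with hbody
  -- Cost of one level of the recursion for inputs of size at most `S`. In the last term, `(S + 2) ^
  -- c₃` bounds the recursive value passed to `s`; it comes from `hF`, without which values could
  -- grow exponentially along the list.
  set B : ℕ → ℕ := fun S => 40 + (S + 2) ^ c₁ + ((S + (S + 2) ^ c₃ + 4) + 2) ^ c₂ with hB
  have key : ∀ S c (l : List α), sz (c, l) ≤ S →
      ∃ k ≤ (l.length + 1) * B S, Eval (R ++ [body]) [enc (c, l)] body (enc (F (c, l))) k := by
    intro S c l
    have hx : ∀ v : Val, Eval (R ++ [body]) [v] x v 1 := fun v => .var rfl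
    induction l with
    | nil =>
      intro hS
      obtain ⟨k, hk, hev⟩ := he₁ c
      have hcS : (sz c + 2) ^ c₁ ≤ (S + 2) ^ c₁ :=
        Nat.pow_le_pow_left (by rw [sz_prod] at hS; omega) _
      have := hT₁ c
      refine ⟨_, ?_, .condNil (.tail (hx _)) (.letIn (.head (hx _)) (?_ : Eval _ _ e₁ _ k))⟩
      · simp only [hB, List.length_nil]; omega
      · rw [h_nil]; exact ((h₁ hev).append_program _).cons_env _
    | cons a l ih =>
      intro hS
      rw [sz_prod, sz_cons] at hS
      obtain ⟨k, hk, hev⟩ := ih (by rw [sz_prod]; omega)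
      obtain ⟨k', hk', hev'⟩ := he₂ (c, a, l, F (c, l))
      have h3 : sz (F (c, l)) ≤ (S + 2) ^ c₃ :=
        (hc₃ _).trans (Nat.pow_le_pow_left (by rw [sz_prod]; omega) _)
      have h4 : (sz (c, a, l, F (c, l)) + 2) ^ c₂ ≤ ((S + (S + 2) ^ c₃ + 4) + 2) ^ c₂ :=
        Nat.pow_le_pow_left (by rw [sz_prod, sz_prod, sz_prod]; omega) _
      have h5 := hT₂ (c, a, l, F (c, l))
      have e0 : Eval (R ++ [body]) [enc (c, a :: l)] (.tail (.tail x)) (enc l) 3 :=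
        .tail (v := enc (a :: l)) (.tail (v := enc (c, a :: l)) (hx _))
      have e1 : Eval (R ++ [body]) [enc (c, a :: l)] (.head x) (enc c) 2 :=
        .head (v := enc (c, a :: l)) (hx _)
      have e2 : Eval (R ++ [body]) [enc (c, a :: l)] (.head (.tail x)) (enc a) 3 :=
        .head (v := enc (a :: l)) (.tail (v := enc (c, a :: l)) (hx _))
      have e3 : Eval (R ++ [body]) [enc (c, a :: l)]
          (.call self (.cons (.head x) (.tail (.tail x)))) (enc (F (c, l))) _ :=
        .call (.cons e1 e0) (by simp [hself]) hev
      refine ⟨_, ?_, .condPair (x := enc a) (y := enc l)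
        (.tail (v := enc (c, a :: l)) (hx _))
        (.letIn (.cons e1 (.cons e2 (.cons e0 e3))) (?_ : Eval _ _ (σ e₂) _ k'))⟩
      · have : (l.length + 1 + 1) * B S = (l.length + 1) * B S + B S := by ring
        rw [List.length_cons, this]
        have : B S ≥ 40 + ((S + (S + 2) ^ c₃ + 4) + 2) ^ c₂ := by simp only [hB]; omega
        omega
      · rw [h_cons]; exact ((h₂ hev').append_program _).cons_env _
  refine ⟨hF, R ++ [body], body, fun p => (sz p + 1) * B (sz p), ?_, fun p => ?_⟩
  · refine (PolyBdd.size.add (.const 1)).mul (((PolyBdd.const _).add ?_).add ?_)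
    · exact (PolyBdd.size.add (.const 2)).pow _
    · exact (((PolyBdd.size.add ((PolyBdd.size.add (.const 2)).pow _)).add (.const 4)).add
        (.const 2)).pow _
  · obtain ⟨c, l⟩ := p
    obtain ⟨k, hk, hev⟩ := key (sz (c, l)) c l le_rfl
    refine ⟨k, hk.trans (Nat.mul_le_mul_right _ ?_), hev⟩
    have := length_lt_sz l
    rw [sz_prod]; omega

end TreeLang

/-! ### A library of polynomial-time functions -/

namespace TreeLang

open Enc

variable {α β γ δ : Type} [Enc α] [Enc β] [Enc γ] [Enc δ]

theorem PolyBdd.of_fst {f : γ → ℕ} (hf : PolyBdd f) : PolyBdd fun p : γ × α => f p.1 :=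
  hf.comp (PolyTime.bdd (by fun_prop))

/-- Structural recursion on a natural number, with a parameter. -/
theorem PolyTime.natRec {F : γ × ℕ → β} {b : γ → β} {s : γ × β → β}
    (hb : PolyTime b) (hs : PolyTime s) (hF : PolyBdd fun x => sz (F x))
    (h_zero : ∀ c, F (c, 0) = b c) (h_succ : ∀ c n, F (c, n + 1) = s (c, F (c, n))) :
    PolyTime F := by
  -- A number in unary is the same tree as a list of that many units, which reduces the claim to
  -- recursion on lists.
  have hl : PolyTime fun p : γ × List Unit => F (p.1, p.2.length) :=
    PolyTime.listRec (s := fun q => s (q.1, q.2.2.2)) hb (by fun_prop)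
      (hF.comp <| PolyBdd.size.mono fun p => by
        obtain ⟨c, l⟩ := p
        have h : List.replicate l.length () = l := (List.eq_replicate_length.2 fun _ _ => rfl).symm
        have h' : sz l.length = sz l := by unfold sz; rw [← enc_replicate, h]
        simp only [sz_prod, h', le_refl])
      (fun c => h_zero c) (fun c a l => h_succ c l.length)
  have hr : PolyTime fun n : ℕ => List.replicate n () := .of_enc_eq enc_replicate
  have := hl.comp (f := fun p : γ × ℕ => (p.1, List.replicate p.2 ())) (by fun_prop)
  simpa using this

theorem PolyTime.iterate {f : γ → ℕ} {g : γ → β → β} {b : γ → β} (hf : PolyTime f)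
    (hb : PolyTime b) (hg : PolyTime fun q : γ × β => g q.1 q.2)
    (hsize : PolyBdd fun p : γ × ℕ => sz ((g p.1)^[p.2] (b p.1))) :
    PolyTime fun c => (g c)^[f c] (b c) := by
  have : PolyTime fun p : γ × ℕ => (g p.1)^[p.2] (b p.1) :=
    PolyTime.natRec hb hg hsize (fun c => rfl)
      (fun c n => by simp only [Function.iterate_succ_apply'])
  exact this.comp (f := fun c => (c, f c)) (by fun_prop)

@[fun_prop]
theorem PolyTime.cons {f : γ → α} {g : γ → List α} (hf : PolyTime f) (hg : PolyTime g) :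
    PolyTime fun c => f c :: g c :=
  PolyTime.comp (g := fun p : α × List α => p.1 :: p.2) (.of_enc_eq fun _ => rfl) (hf.pair hg)

@[fun_prop]
theorem PolyTime.succ {f : γ → ℕ} (hf : PolyTime f) : PolyTime fun c => f c + 1 :=
  PolyTime.comp (g := fun p : Unit × ℕ => p.2 + 1) (.of_enc_eq fun _ => rfl)
    ((PolyTime.const ()).pair hf)

@[fun_prop]
theorem PolyTime.headD {f : γ → List α} {g : γ → α} (hf : PolyTime f) (hg : PolyTime g) :
    PolyTime fun c => (f c).headD (g c) := by
  have : PolyTime fun p : α × List α => p.2.headD p.1 := by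
    refine PolyTime.listRec (b := fun c => c) (s := fun q => q.2.1) (by fun_prop) (by fun_prop)
      (PolyBdd.size.mono fun p => ?_) (fun c => rfl) (fun c a l => rfl)
    obtain ⟨c, _ | ⟨x, l⟩⟩ := p
    · simp only [List.headD_nil, sz_prod]; omega
    · simp only [List.headD_cons, sz_prod, sz_cons]; omega
  exact this.comp (hg.pair hf)

@[fun_prop]
theorem PolyTime.tail {f : γ → List α} (hf : PolyTime f) : PolyTime fun c => (f c).tail := by
  have : PolyTime fun p : Unit × List α => p.2.tail := by
    refine PolyTime.listRec (b := fun _ => []) (s := fun q => q.2.2.1) (by fun_prop) (by fun_prop)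
      (PolyBdd.size.mono fun p => ?_) (fun c => rfl) (fun c a l => rfl)
    obtain ⟨c, _ | ⟨x, l⟩⟩ := p
    · simp only [List.tail_nil, sz_prod]; omega
    · simp only [List.tail_cons, sz_prod, sz_cons]; omega
  exact this.comp ((PolyTime.const ()).pair hf)

theorem PolyBdd.of_bool (f : γ → Bool) : PolyBdd fun c => sz (f c) :=
  (PolyBdd.const 3).mono fun _ => sz_bool _

@[fun_prop]
theorem PolyTime.isEmpty {f : γ → List α} (hf : PolyTime f) :
    PolyTime fun c => (f c).isEmpty := by
  have : PolyTime fun p : Unit × List α => p.2.isEmpty :=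
    PolyTime.listRec (b := fun _ => true) (s := fun _ => false) (by fun_prop) (by fun_prop)
      (.of_bool _) (fun c => rfl) (fun c a l => rfl)
  exact this.comp ((PolyTime.const ()).pair hf)

@[fun_prop]
theorem PolyTime.not {f : γ → Bool} (hf : PolyTime f) : PolyTime fun c => !(f c) := by
  have : PolyTime fun c => if f c then false else true := by fun_prop
  convert this with c
  cases f c <;> rfl

@[fun_prop]
theorem PolyTime.and {f g : γ → Bool} (hf : PolyTime f) (hg : PolyTime g) :
    PolyTime fun c => f c && g c := by
  have : PolyTime fun c => if f c then g c else false := by fun_prop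
  convert this with c
  cases f c <;> simp

@[fun_prop]
theorem PolyTime.or {f g : γ → Bool} (hf : PolyTime f) (hg : PolyTime g) :
    PolyTime fun c => f c || g c := by
  have : PolyTime fun c => if f c then true else g c := by fun_prop
  convert this with c
  cases f c <;> simp

@[fun_prop]
theorem PolyTime.any {f : γ → List α} {p : γ → α → Bool} (hf : PolyTime f)
    (hp : PolyTime fun q : γ × α => p q.1 q.2) : PolyTime fun c => (f c).any (p c) := by
  have : PolyTime fun q : γ × List α => q.2.any (p q.1) := by
    have h := hp.comp (f := fun q : γ × α × List α × Bool => (q.1, q.2.1)) (by fun_prop)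
    exact PolyTime.listRec (b := fun _ => false) (s := fun q => p q.1 q.2.1 || q.2.2.2)
      (by fun_prop) (by fun_prop) (.of_bool _) (fun c => rfl) (fun c a l => rfl)
  exact this.comp (PolyTime.id.pair hf)

@[fun_prop]
theorem PolyTime.all {f : γ → List α} {p : γ → α → Bool} (hf : PolyTime f)
    (hp : PolyTime fun q : γ × α => p q.1 q.2) : PolyTime fun c => (f c).all (p c) := by
  have : PolyTime fun c => !((f c).any fun a => !(p c a)) := by fun_prop
  simpa [List.not_any_eq_all_not] using this

@[fun_prop]
theorem PolyTime.filter {f : γ → List α} {p : γ → α → Bool} (hf : PolyTime f)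
    (hp : PolyTime fun q : γ × α => p q.1 q.2) : PolyTime fun c => (f c).filter (p c) := by
  have : PolyTime fun q : γ × List α => q.2.filter (p q.1) := by
    have h := hp.comp (f := fun q : γ × α × List α × List α => (q.1, q.2.1)) (by fun_prop)
    refine PolyTime.listRec (b := fun _ => [])
      (s := fun q => if p q.1 q.2.1 then q.2.1 :: q.2.2.2 else q.2.2.2) (by fun_prop)
      (by fun_prop) (PolyBdd.size.mono fun q => ?_) (fun c => rfl) (fun c a l => ?_)
    · obtain ⟨c, l⟩ := q
      have := sz_le_of_subperm (List.filter_sublist (l := l) (p := p c)).subperm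
      simp only [sz_prod]; omega
    · simp [List.filter_cons]
  exact this.comp (PolyTime.id.pair hf)

theorem sz_append_lt (l l' : List α) : sz (l ++ l') < sz l + sz l' := by
  rw [sz_eq_sum, sz_eq_sum l, sz_eq_sum l', List.map_append, List.sum_append]
  omega

@[fun_prop]
theorem PolyTime.append {f g : γ → List α} (hf : PolyTime f) (hg : PolyTime g) :
    PolyTime fun c => f c ++ g c := by
  have : PolyTime fun q : List α × List α => q.2 ++ q.1 := by
    refine PolyTime.listRec (b := fun c => c) (s := fun q => q.2.1 :: q.2.2.2) (by fun_prop)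
      (by fun_prop) (PolyBdd.size.mono fun q => ?_) (fun c => rfl) (fun c a l => rfl)
    obtain ⟨c, l⟩ := q
    have := sz_append_lt l c
    simp only [sz_prod]; omega
  exact this.comp (hg.pair hf)

@[fun_prop]
theorem PolyTime.flatMap {f : γ → List α} {g : γ → α → List β} (hf : PolyTime f)
    (hg : PolyTime fun q : γ × α => g q.1 q.2) : PolyTime fun c => (f c).flatMap (g c) := by
  have : PolyTime fun q : γ × List α => q.2.flatMap (g q.1) := by
    have h := hg.comp (f := fun q : γ × α × List α × List β => (q.1, q.2.1)) (by fun_prop)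
    obtain ⟨k, hk⟩ := hg.bdd
    refine PolyTime.listRec (b := fun _ => []) (s := fun q => g q.1 q.2.1 ++ q.2.2.2)
      (by fun_prop) (by fun_prop)
      (((PolyBdd.size.mul ((PolyBdd.size.add (.const 2)).pow k)).add (.const 1)).mono
        fun q => ?_) (fun c => rfl) (fun c a l => by simp)
    obtain ⟨c, l⟩ := q
    -- The bound per element is stated with the size of the whole `l`, so that it stays fixed during
    -- the induction on `l'`.
    have key : ∀ l' : List α, (∀ a ∈ l', a ∈ l) →
        sz (l'.flatMap (g c)) ≤ l'.length * (sz (c, l) + 2) ^ k + 1 := by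
      intro l' hl'
      induction l' with
      | nil => simp [sz_nil]
      | cons a l' ih =>
        have h₁ := ih fun b hb => hl' b (by simp [hb])
        have h₂ := (hk (c, a)).trans (Nat.pow_le_pow_left (m := sz (c, l) + 2) (by
          have := sz_le_of_mem (hl' a (by simp))
          simp only [sz_prod]; omega) k)
        have h₃ := sz_append_lt (g c a) (l'.flatMap (g c))
        rw [List.flatMap_cons, List.length_cons, add_mul]
        simp only at h₂
        omega
    refine (key l fun _ h => h).trans ?_
    gcongr
    have := length_lt_sz l
    simp only [sz_prod]; omega
  exact this.comp (PolyTime.id.pair hf)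

@[fun_prop]
theorem PolyTime.map {f : γ → List α} {g : γ → α → β} (hf : PolyTime f)
    (hg : PolyTime fun q : γ × α => g q.1 q.2) : PolyTime fun c => (f c).map (g c) := by
  have : PolyTime fun c => (f c).flatMap fun a => [g c a] := by fun_prop
  simpa [← List.map_eq_flatMap] using this

@[fun_prop]
theorem PolyTime.length {f : γ → List α} (hf : PolyTime f) : PolyTime fun c => (f c).length := by
  have : PolyTime fun q : Unit × List α => q.2.length := by
    refine PolyTime.listRec (b := fun _ => 0) (s := fun q => q.2.2.2 + 1) (by fun_prop)
      (by fun_prop) ((PolyBdd.size.mul (.const 2)).mono fun q => ?_) (fun c => rfl)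
      (fun c a l => rfl)
    obtain ⟨c, l⟩ := q
    have := length_lt_sz l
    simp only [sz_nat, sz_prod]; omega
  exact this.comp ((PolyTime.const ()).pair hf)

@[fun_prop]
theorem PolyTime.drop {f : γ → ℕ} {g : γ → List α} (hf : PolyTime f) (hg : PolyTime g) :
    PolyTime fun c => (g c).drop (f c) := by
  have : PolyTime fun q : List α × ℕ => q.1.drop q.2 := by
    refine PolyTime.natRec (b := fun c => c) (s := fun q => q.2.tail) (by fun_prop)
      (by fun_prop) (PolyBdd.size.mono fun q => ?_) (fun c => rfl)
      (fun c n => by simp only [List.tail_drop])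
    obtain ⟨l, n⟩ := q
    have := sz_le_of_subperm (List.drop_sublist n l).subperm
    simp only [sz_prod]; omega
  exact this.comp (hg.pair hf)

@[fun_prop]
theorem PolyTime.getD {f : γ → ℕ} {g : γ → List α} (hf : PolyTime f) (hg : PolyTime g) (a : α) :
    PolyTime fun c => (g c).getD (f c) a := by
  have : PolyTime fun c => ((g c).drop (f c)).headD a := by fun_prop
  convert this using 2 with c
  rw [List.headD_eq_head?_getD, List.head?_drop, List.getD_eq_getElem?_getD]

@[fun_prop]
theorem PolyTime.lt {f g : γ → ℕ} (hf : PolyTime f) (hg : PolyTime g) :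
    PolyTime fun c => decide (f c < g c) := by
  have hr : PolyTime fun n : ℕ => List.replicate n () := .of_enc_eq enc_replicate
  have : PolyTime fun c => !((List.replicate (g c) ()).drop (f c)).isEmpty := by fun_prop
  convert this with c
  rw [Bool.eq_iff_iff]
  simp only [List.drop_replicate, List.isEmpty_replicate, decide_eq_true_eq, Bool.not_eq_true',
    decide_eq_false_iff_not]
  omega

@[fun_prop]
theorem PolyTime.beq {f g : γ → ℕ} (hf : PolyTime f) (hg : PolyTime g) :
    PolyTime fun c => f c == g c := by
  have : PolyTime fun c => !(decide (f c < g c)) && !(decide (g c < f c)) := by fun_prop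
  convert this with c
  grind

@[fun_prop]
theorem PolyTime.mul {f g : γ → ℕ} (hf : PolyTime f) (hg : PolyTime g) :
    PolyTime fun c => f c * g c := by
  have hr : PolyTime fun n : ℕ => List.replicate n () := .of_enc_eq enc_replicate
  have : PolyTime fun c =>
    ((List.replicate (f c) ()).flatMap fun _ => List.replicate (g c) ()).length := by fun_prop
  simpa using this

@[fun_prop]
theorem PolyTime.range {f : γ → ℕ} (hf : PolyTime f) : PolyTime fun c => List.range (f c) := by
  have : PolyTime fun q : Unit × ℕ => List.range q.2 := by
    refine PolyTime.natRec (b := fun _ => []) (s := fun q => q.2 ++ [q.2.length]) (by fun_prop)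
      (by fun_prop) ((((PolyBdd.size.mul PolyBdd.size)).add (.const 1)).mono fun q => ?_)
      (fun c => rfl) (fun c n => by simp [List.range_succ])
    obtain ⟨c, n⟩ := q
    have := sz_le_of_forall (l := List.range n) (s := 2 * n) fun a ha => by
      rw [sz_nat]; have := List.mem_range.1 ha; omega
    rw [List.length_range] at this
    refine this.trans ?_
    rw [sz_prod, sz_nat, add_comm]
    have := one_le_sz c
    gcongr <;> omega
  exact this.comp ((PolyTime.const ()).pair hf)

/-! ### Binary recursion -/

/-- The recursion tree of `F x = if leaf x then base x else comb (x, F (left x), F (right x))`: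
`RecTree leaf base left right comb S x y m` says that the recursion started at `x` ends with the
value `y`, that it has `m` leaves, and that all arguments and values met have size at
most `S`. -/
inductive RecTree (leaf : α → Bool) (base : α → β) (left right : α → α) (comb : α × β × β → β)
    (S : ℕ) : α → β → ℕ → Prop
  | leaf {x : α} (h : leaf x = true) (hx : sz x ≤ S) :
      RecTree leaf base left right comb S x (base x) 1
  | node {x : α} {a b : β} {m n : ℕ} (h : leaf x = false) (hx : sz x ≤ S) (ha : sz a ≤ S)
      (hb : sz b ≤ S) (hl : RecTree leaf base left right comb S (left x) a m)
      (hr : RecTree leaf base left right comb S (right x) b n) :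
      RecTree leaf base left right comb S x (comb (x, a, b)) (m + n)

theorem RecTree.one_le {leaf : α → Bool} {base : α → β} {left right : α → α}
    {comb : α × β × β → β} {S : ℕ} {x : α} {y : β} {m : ℕ}
    (h : RecTree leaf base left right comb S x y m) : 1 ≤ m := by
  induction h with
  | leaf => exact le_rfl
  | node _ _ _ _ _ _ ih _ => exact ih.trans (Nat.le_add_right _ _)

/-- The time of a binary recursion with polynomial-time steps is the number of leaves of the
recursion tree, up to a polynomial factor. -/
theorem RecTree.exists_eval {leaf : α → Bool} {base : α → β} {left right : α → α}
    {comb : α × β × β → β} (h_leaf : PolyTime leaf) (h_base : PolyTime base)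
    (h_left : PolyTime left) (h_right : PolyTime right) (h_comb : PolyTime comb) :
    ∃ (P : Program) (e : Expr) (c : ℕ), ∀ S x y m, RecTree leaf base left right comb S x y m →
      ∃ k ≤ m * (S + 2) ^ c, Eval P [enc x] e (enc y) k := by
  obtain ⟨-, P₁, e₁, T₁, ⟨c₁, hT₁⟩, he₁⟩ := h_leaf
  obtain ⟨-, P₂, e₂, T₂, ⟨c₂, hT₂⟩, he₂⟩ := h_base
  obtain ⟨-, P₃, e₃, T₃, ⟨c₃, hT₃⟩, he₃⟩ := h_left
  obtain ⟨-, P₄, e₄, T₄, ⟨c₄, hT₄⟩, he₄⟩ := h_right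
  obtain ⟨-, P₅, e₅, T₅, ⟨c₅, hT₅⟩, he₅⟩ := h_comb
  obtain ⟨R₄, σ₄, h₄, h₄'⟩ := exists_link P₄ P₅
  obtain ⟨R₃, σ₃, h₃, h₃'⟩ := exists_link P₃ R₄
  obtain ⟨R₂, σ₂, h₂, h₂'⟩ := exists_link P₂ R₃
  obtain ⟨R, σ₁, h₁, h₁'⟩ := exists_link P₁ R₂
  set self := R.length with hself
  set body : Expr := .cond e₁ (σ₁ e₂)
    (.letIn (.cons (.var 0) (.cons (.call self (σ₁ (σ₂ e₃))) (.call self (σ₁ (σ₂ (σ₃ e₄))))))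
      (σ₁ (σ₂ (σ₃ (σ₄ e₅))))) with hbody
  set B : ℕ → ℕ := fun S => 20 + (S + 2) ^ c₁ + (S + 2) ^ c₂ + (S + 2) ^ c₃ + (S + 2) ^ c₄ +
    (3 * S + 4) ^ c₅ with hB
  -- A binary tree with m leaves has 2m-1 nodes, each of cost at most `B S`. The summand `B S` on
  -- the left accounts for the -1 and lets the induction close.
  have key : ∀ S x y m, RecTree leaf base left right comb S x y m →
      ∃ k, k + B S ≤ 2 * m * B S ∧ Eval (R ++ [body]) [enc x] body (enc y) k := by
    intro S x y m h
    induction h with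
    | @leaf x h hx =>
      obtain ⟨k₁, hk₁, hev₁⟩ := he₁ x
      obtain ⟨k₂, hk₂, hev₂⟩ := he₂ x
      rw [h, enc_true] at hev₁
      have b₁ := (hT₁ x).trans (Nat.pow_le_pow_left (Nat.add_le_add_right hx 2) _)
      have b₂ := (hT₂ x).trans (Nat.pow_le_pow_left (Nat.add_le_add_right hx 2) _)
      refine ⟨_, ?_, .condPair ((h₁ hev₁).append_program _)
        ((h₁' (h₂ hev₂)).append_program _)⟩
      simp only [hB]; omega
    | @node x a b m n h hx ha hb _ _ ihl ihr =>
      obtain ⟨k₁, hk₁, hev₁⟩ := he₁ x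
      obtain ⟨k₃, hk₃, hev₃⟩ := he₃ x
      obtain ⟨k₄, hk₄, hev₄⟩ := he₄ x
      obtain ⟨k₅, hk₅, hev₅⟩ := he₅ (x, a, b)
      obtain ⟨k, hk, hev⟩ := ihl
      obtain ⟨k', hk', hev'⟩ := ihr
      rw [h, enc_false] at hev₁
      have b₁ := (hT₁ x).trans (Nat.pow_le_pow_left (Nat.add_le_add_right hx 2) _)
      have b₃ := (hT₃ x).trans (Nat.pow_le_pow_left (Nat.add_le_add_right hx 2) _)
      have b₄ := (hT₄ x).trans (Nat.pow_le_pow_left (Nat.add_le_add_right hx 2) _)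
      have b₅ := (hT₅ (x, a, b)).trans (Nat.pow_le_pow_left (m := 3 * S + 4)
        (by rw [sz_prod, sz_prod]; omega) _)
      have hf : (R ++ [body])[self]? = some body := by simp [hself]
      refine ⟨_, ?_, .condNil ((h₁ hev₁).append_program _) (.letIn (.cons (.var rfl)
        (.cons (.call ((h₁' (h₂' (h₃ hev₃))).append_program _) hf hev)
          (.call ((h₁' (h₂' (h₃' (h₄ hev₄)))).append_program _) hf hev')))
        (((h₁' (h₂' (h₃' (h₄' hev₅)))).append_program _).cons_env _))⟩
      have : 2 * (m + n) * B S = 2 * m * B S + 2 * n * B S := by ring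
      rw [this]
      have : B S ≥ 20 + (S + 2) ^ c₁ + (S + 2) ^ c₃ + (S + 2) ^ c₄ + (3 * S + 4) ^ c₅ := by
        simp only [hB]; omega
      omega
  have hpoly : PolyBdd fun n : ℕ => 2 * B n := by
    have hs : PolyBdd fun n : ℕ => n + 2 := (PolyBdd.size (α := ℕ)).add (.const 1) |>.mono
      fun n => by rw [sz_nat]; omega
    have hs' : PolyBdd fun n : ℕ => 3 * n + 4 := (hs.mul (.const 3)).mono fun n => by omega
    exact (PolyBdd.const 2).mul (((((((PolyBdd.const 20).add (hs.pow _)).add (hs.pow _)).add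
      (hs.pow _)).add (hs.pow _))).add (hs'.pow _))
  obtain ⟨c, hc⟩ := hpoly
  refine ⟨R ++ [body], body, 2 * c, fun S x y m h => ?_⟩
  obtain ⟨k, hk, hev⟩ := key S x y m h
  refine ⟨k, ?_, hev⟩
  -- The unary size of `S` is 2S+1, and 2S+3 ≤ (S+2)^2; this doubles the exponent.
  have h₁ : 2 * B S ≤ (S + 2) ^ (2 * c) := by
    refine (hc S).trans ?_
    rw [pow_mul]
    refine Nat.pow_le_pow_left ?_ _
    rw [sz_nat]; nlinarith
  calc k ≤ 2 * m * B S := by omega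
    _ = m * (2 * B S) := by ring
    _ ≤ _ := Nat.mul_le_mul_left _ h₁

end TreeLang

/-! ### Connected sets and components -/

namespace SimpleGraph

variable {V : Type*} (G : SimpleGraph V)

/-- `A` contains all neighbours in `Y` of its elements. -/
def ClosedIn (Y A : Finset V) : Prop := ∀ a ∈ A, ∀ y ∈ Y, G.Adj a y → y ∈ A

/-- `C` induces a connected subgraph: no proper nonempty subset is closed under adjacency. -/
def ConnectedOn (C : Finset V) : Prop := ∀ A ⊆ C, A.Nonempty → G.ClosedIn C A → A = C

/-- `C` is the vertex set of a component of the subgraph induced by `Y`. -/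
structure IsComponent (Y C : Finset V) : Prop where
  subset : C ⊆ Y
  nonempty : C.Nonempty
  connected : G.ConnectedOn C
  closed : G.ClosedIn Y C

/-- `A` is an independent set. -/
def Indep (A : Finset V) : Prop := ∀ a ∈ A, ∀ b ∈ A, ¬ G.Adj a b

/-- No vertex of `X` has `m` independent neighbours in `X`. -/
def StarFreeOn (m : ℕ) (X : Finset V) : Prop :=
  ∀ v ∈ X, ∀ S ⊆ X, (∀ s ∈ S, G.Adj v s) → G.Indep S → S.card < m

open Classical in
/-- The elements of `X` outside the closed neighbourhood of `Q`. -/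
noncomputable def away (X Q : Finset V) : Finset V :=
  X.filter fun u => ∀ w ∈ Q, w ≠ u ∧ ¬ G.Adj w u

variable {G}

theorem mem_away {X Q : Finset V} {u : V} :
    u ∈ G.away X Q ↔ u ∈ X ∧ ∀ w ∈ Q, w ≠ u ∧ ¬ G.Adj w u := by
  simp [away]

theorem Indep.mono {A B : Finset V} (h : G.Indep B) (hAB : A ⊆ B) : G.Indep A :=
  fun a ha b hb => h a (hAB ha) b (hAB hb)

theorem ConnectedOn.exists_adj {C A : Finset V} (hC : G.ConnectedOn C) (hA : A ⊂ C)
    (hne : A.Nonempty) : ∃ a ∈ A, ∃ y ∈ C, G.Adj a y ∧ y ∉ A := by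
  by_contra! h
  exact hA.ne (hC A hA.subset hne fun a ha y hy hay => h a ha y hy hay)

/-- A component of a smaller set lies in any component that it meets. -/
theorem IsComponent.subset_of_inter {Y Y' C C' : Finset V} [DecidableEq V]
    (hC : G.IsComponent Y C) (hC' : G.IsComponent Y' C') (h : Y' ⊆ Y) (hne : (C' ∩ C).Nonempty) :
    C' ⊆ C := by
  have := hC'.connected (C' ∩ C) Finset.inter_subset_left hne fun a ha y hy hay => by
    rw [Finset.mem_inter] at ha ⊢
    exact ⟨hy, hC.closed a ha.2 y (h (hC'.subset hy)) hay⟩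
  exact Finset.inter_eq_left.1 this

/-! ### Brooms from stars -/

/-- The data of a broom in the making: an induced path `p 0, …, p m`, a set `L` of `d` leaves at
`p 0`, and a connected set `C` that sees only the last vertex `p m` of all these vertices. -/
structure IsBroomAt (G : SimpleGraph V) (d m : ℕ) (p : ℕ → V) (L C : Finset V) : Prop where
  path : ∀ i j, i < j → j ≤ m → (G.Adj (p i) (p j) ↔ j = i + 1) ∧ p i ≠ p j
  card_leaves : L.card = d
  indep : G.Indep L
  adj : ∀ l ∈ L, G.Adj (p 0) l
  not_adj : ∀ l ∈ L, ∀ i, 0 < i → i ≤ m → ¬ G.Adj (p i) l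
  notMem : ∀ i ≤ m, p i ∉ L
  path_away : ∀ i < m, ∀ c ∈ C, p i ≠ c ∧ ¬ G.Adj (p i) c
  leaf_away : ∀ l ∈ L, ∀ c ∈ C, l ≠ c ∧ ¬ G.Adj l c
  last_notMem : p m ∉ C
  last_adj : ∃ c ∈ C, G.Adj (p m) c

theorem IsBroomAt.isIndContained {d m t : ℕ} {p : ℕ → V} {L C : Finset V}
    (h : G.IsBroomAt d m p L C) (ht : t ≤ m + 1) : (broom d t).IsIndContained G := by
  let e := L.equivFinOfCardEq h.card_leaves
  let f : Fin t ⊕ Fin d → V := Sum.elim (fun i => p i) (fun j => (e.symm j : V))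
  have hlt : ∀ i j : Fin t, i < j → (G.Adj (p i) (p j) ↔ (j : ℕ) = i + 1) ∧ p i ≠ p j :=
    fun i j hij => h.path i j hij (by omega)
  have hinj : Function.Injective f := by
    rintro (i | i) (j | j) hij
    · rcases lt_trichotomy i j with hlt' | rfl | hlt'
      · exact absurd hij (hlt i j hlt').2
      · rfl
      · exact absurd hij.symm (hlt j i hlt').2
    · exact absurd ((show p i = e.symm j from hij) ▸ (e.symm j).2 : p i ∈ L) (h.notMem i (by omega))
    · exact absurd ((show p j = e.symm i from hij.symm) ▸ (e.symm i).2 : p j ∈ L)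
        (h.notMem j (by omega))
    · exact congrArg Sum.inr (e.symm.injective (Subtype.ext hij))
  have hleaf : ∀ (i : Fin t) (j : Fin d), G.Adj (p i) (e.symm j) ↔ i.val = 0 := by
    intro i j
    constructor
    · intro hadj
      by_contra h0
      exact h.not_adj _ (e.symm j).2 i (by omega) (by omega) hadj
    · intro h0
      rw [h0]
      exact h.adj _ (e.symm j).2
  refine ⟨⟨⟨f, hinj⟩, ?_⟩⟩
  rintro (i | i) (j | j)
  · change G.Adj (p i) (p j) ↔ (pathGraph t).Adj i j
    rw [pathGraph_adj]
    rcases lt_trichotomy i j with hlt' | rfl | hlt'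
    · rw [(hlt i j hlt').1]
      have : i.val < j.val := hlt'
      omega
    · simp
    · rw [G.adj_comm, (hlt j i hlt').1]
      have : j.val < i.val := hlt'
      omega
  · exact hleaf i j
  · exact (G.adj_comm _ _).trans (hleaf j i)
  · change G.Adj (e.symm i) (e.symm j) ↔ False
    exact iff_false_intro (h.indep _ (e.symm i).2 _ (e.symm j).2)

/-- Either `Q` leaves only components of less than half the size of `X`, or the broom can be
extended by one vertex. -/
theorem IsBroomAt.extend [DecidableEq V] {X Q C C' L : Finset V} {d m : ℕ} {p : ℕ → V}
    (h : G.IsBroomAt d m p L C) (hQX : Q ⊆ X) (hQ : Q.Nonempty)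
    (hC : G.IsComponent (G.away X Q) C) (hcard : X.card ≤ 2 * C.card)
    (hC' : G.IsComponent (G.away X (insert (p m) Q)) C') (hcard' : X.card ≤ 2 * C'.card) :
    ∃ v ∈ X, G.IsBroomAt d (m + 1) (fun i => if i = m + 1 then v else p i) L C' := by
  have hsub : G.away X (insert (p m) Q) ⊆ G.away X Q := by
    intro u hu
    rw [mem_away] at hu ⊢
    exact ⟨hu.1, fun w hw => hu.2 w (Finset.mem_insert_of_mem hw)⟩
  -- Two disjoint sets, each with at least half of `X`, would exhaust `X`; but both avoid the
  -- nonempty set `Q`.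
  have hmeet : (C' ∩ C).Nonempty := by
    by_contra hne
    rw [Finset.not_nonempty_iff_eq_empty, ← Finset.disjoint_iff_inter_eq_empty] at hne
    obtain ⟨x, hx⟩ := hQ
    have hss : C' ∪ C ⊆ X.erase x := by
      intro u hu
      have hu' : u ∈ G.away X Q := by
        rcases Finset.mem_union.1 hu with hu | hu
        · exact hsub (hC'.subset hu)
        · exact hC.subset hu
      rw [mem_away] at hu'
      exact Finset.mem_erase.2 ⟨(hu'.2 x hx).1.symm, hu'.1⟩
    have h₁ := Finset.card_le_card hss
    rw [Finset.card_union_of_disjoint hne] at h₁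
    have h₂ := Finset.card_erase_lt_of_mem (hQX hx)
    omega
  have hCC : C' ⊆ C := hC.subset_of_inter hC' hsub hmeet
  have haway : ∀ c ∈ C', p m ≠ c ∧ ¬ G.Adj (p m) c := fun c hc =>
    (mem_away.1 (hC'.subset hc)).2 (p m) (Finset.mem_insert_self _ _)
  obtain ⟨c₀, hc₀, hadj₀⟩ := h.last_adj
  have hssub : C' ⊂ C := (Finset.ssubset_iff_of_subset hCC).2
    ⟨c₀, hc₀, fun hc => (haway c₀ hc).2 hadj₀⟩
  -- The new path vertex `v` lies in `C`, which only the end `p m` of the old broom sees, and just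
  -- outside `C'`.
  obtain ⟨a, ha, v, hv, hav, hvC'⟩ := hC.connected.exists_adj hssub hC'.nonempty
  have hvX := mem_away.1 (hC.subset hv)
  -- Otherwise `v` would survive the removal of the closed neighbourhood of `p m` and join `C'`
  -- through `a`.
  have hmv : G.Adj (p m) v := by
    by_contra hnot
    refine hvC' (hC'.closed a ha v (mem_away.2 ⟨hvX.1, fun w hw => ?_⟩) hav)
    rcases Finset.mem_insert.1 hw with rfl | hw
    · exact ⟨fun heq => h.last_notMem (heq ▸ hv), hnot⟩
    · exact hvX.2 w hw
  refine ⟨v, hvX.1, ?_⟩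
  have hp : ∀ i ≤ m, (if i = m + 1 then v else p i) = p i := fun i hi => if_neg (by omega)
  have hpv : (if m + 1 = m + 1 then v else p (m + 1)) = v := if_pos rfl
  refine ⟨fun i j hij hj => ?_, h.card_leaves, h.indep, fun l hl => ?_, fun l hl i hi him => ?_,
    fun i hi => ?_, fun i hi c hc => ?_, fun l hl c hc => h.leaf_away l hl c (hCC hc), ?_, ?_⟩
  · rw [hp i (by omega)]
    rcases Nat.lt_or_ge m j with hmj | hmj
    · obtain rfl : j = m + 1 := by omega
      rw [hpv]
      rcases Nat.lt_or_ge i m with him | him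
      · have := h.path_away i him v hv
        exact ⟨iff_of_false this.2 (by omega), this.1⟩
      · obtain rfl : i = m := by omega
        exact ⟨iff_of_true hmv rfl, hmv.ne⟩
    · rw [hp j hmj]
      exact h.path i j hij hmj
  · rw [hp 0 (by omega)]
    exact h.adj l hl
  · rcases Nat.lt_or_ge m i with hmi | hmi
    · obtain rfl : i = m + 1 := by omega
      rw [hpv, G.adj_comm]
      exact (h.leaf_away l hl v hv).2
    · rw [hp i hmi]
      exact h.not_adj l hl i hi hmi
  · rcases Nat.lt_or_ge m i with hmi | hmi
    · obtain rfl : i = m + 1 := by omega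
      rw [hpv]
      exact fun hvL => (h.leaf_away v hvL v hv).1 rfl
    · rw [hp i hmi]
      exact h.notMem i hmi
  · rw [hp i (by omega)]
    rcases Nat.lt_or_ge i m with him | him
    · exact h.path_away i him c (hCC hc)
    · obtain rfl : i = m := by omega
      exact haway c hc
  · rw [hpv]; exact hvC'
  · rw [hpv]; exact ⟨a, ha, hav.symm⟩

/-- A star with `2d` leaves from which a large connected set has been separated is part of
a broom. -/
theorem exists_isBroomAt [DecidableEq V] {X S C : Finset V} {v : V} {d : ℕ}
    (hX : G.ConnectedOn X) (hv : v ∈ X) (hvS : ∀ s ∈ S, G.Adj v s)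
    (hS : G.Indep S) (hcard : S.card = 2 * d)
    (hC : G.IsComponent (G.away X (insert v S)) C) :
    ∃ m p L, p m ∈ X ∧ G.IsBroomAt d m p L C := by
  have hvC : v ∉ C := fun h =>
    ((mem_away.1 (hC.subset h)).2 v (Finset.mem_insert_self _ _)).1 rfl
  have hCX : C ⊆ X := fun u hu => (mem_away.1 (hC.subset hu)).1
  have hfar : ∀ x ∈ insert v S, ∀ c ∈ C, x ≠ c ∧ ¬ G.Adj x c := fun x hx c hc =>
    (mem_away.1 (hC.subset hc)).2 x hx
  have hfarv := hfar v (Finset.mem_insert_self _ _)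
  have hfarS : ∀ s ∈ S, ∀ c ∈ C, s ≠ c ∧ ¬ G.Adj s c := fun s hs =>
    hfar s (Finset.mem_insert_of_mem hs)
  -- The path will end at `w`, a vertex outside `C` with a neighbour in `C`; it is not in the star,
  -- whose vertices see nothing of `C`.
  obtain ⟨a, ha, w, hw, haw, hwC⟩ := hX.exists_adj
    ((Finset.ssubset_iff_of_subset hCX).2 ⟨v, hv, hvC⟩) hC.nonempty
  have hwQ : w ∉ insert v S := fun h => (hfar w h a ha).2 haw.symm
  have hwv : w ≠ v := fun h => hwQ (h ▸ Finset.mem_insert_self _ _)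
  have hwS : w ∉ S := fun h => hwQ (Finset.mem_insert_of_mem h)
  have hvS' : v ∉ S := fun h => G.irrefl (hvS v h)
  classical
  have hsplit := Finset.card_filter_add_card_filter_not (s := S) (fun s => G.Adj w s)
  -- Of the 2d leaves, at least d are neighbours of `w` or at least d are not. In the first case `w`
  -- itself becomes the centre. In the second the nonneighbours are the leaves, and the path goes
  -- from `v` to `w`, directly or through a star leaf adjacent to `w`.
  by_cases hmany : d ≤ (S.filter fun s => G.Adj w s).card
  · obtain ⟨L, hLS, hL⟩ := Finset.exists_subset_card_eq hmany
    have hLmem : ∀ l ∈ L, l ∈ S ∧ G.Adj w l := fun l hl => Finset.mem_filter.1 (hLS hl)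
    refine ⟨0, fun _ => w, L, hw, ⟨fun i j hij hj => by omega, hL,
      hS.mono fun l hl => (hLmem l hl).1, fun l hl => (hLmem l hl).2,
      fun l hl i hi hi' => by omega, fun i _ h => hwS (hLmem w h).1, fun i hi => by omega,
      fun l hl => hfarS l (hLmem l hl).1, hwC, a, ha, haw.symm⟩⟩
  have hrest : d ≤ (S.filter fun s => ¬ G.Adj w s).card := by omega
  obtain ⟨L, hLS, hL⟩ := Finset.exists_subset_card_eq hrest
  have hLmem : ∀ l ∈ L, l ∈ S ∧ ¬ G.Adj w l := fun l hl => Finset.mem_filter.1 (hLS hl)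
  have hLind : G.Indep L := hS.mono fun l hl => (hLmem l hl).1
  by_cases hwadj : G.Adj v w
  · refine ⟨1, fun i => if i = 0 then v else w, L, by simpa using hw,
      ⟨fun i j hij hj => ?_, hL, hLind, fun l hl => by simpa using hvS l (hLmem l hl).1,
      fun l hl i hi hi' => ?_, fun i hi => ?_, fun i hi => ?_,
      fun l hl => hfarS l (hLmem l hl).1, by simpa using hwC, a, ha, by simpa using haw.symm⟩⟩
    · obtain ⟨rfl, rfl⟩ : i = 0 ∧ j = 1 := by omega
      simpa using ⟨hwadj, hwv.symm⟩
    · obtain rfl : i = 1 := by omega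
      simpa using (hLmem l hl).2
    · split_ifs
      · exact fun h => hvS' (hLmem _ h).1
      · exact fun h => hwS (hLmem _ h).1
    · obtain rfl : i = 0 := by omega
      simpa using hfarv
  · have hex : ∃ s ∈ S, G.Adj w s := by
      -- If the star did not touch `w`, then `w` would belong to the component `C` of its neighbour
      -- `a`.
      by_contra! hno
      refine hwC (hC.closed a ha w (mem_away.2 ⟨hw, fun x hx => ?_⟩) haw)
      rcases Finset.mem_insert.1 hx with rfl | hx
      · exact ⟨hwv.symm, hwadj⟩
      · exact ⟨fun h => hwS (h ▸ hx), fun h => hno x hx h.symm⟩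
    obtain ⟨s, hs, hws⟩ := hex
    have hvs := hvS s hs
    refine ⟨2, fun i => if i = 0 then v else if i = 1 then s else w, L, by simpa using hw,
      ⟨fun i j hij hj => ?_, hL, hLind, fun l hl => by simpa using hvS l (hLmem l hl).1,
      fun l hl i hi hi' => ?_, fun i hi => ?_, fun i hi => ?_,
      fun l hl => hfarS l (hLmem l hl).1, by simpa using hwC, a, ha, by simpa using haw.symm⟩⟩
    · obtain ⟨rfl, rfl⟩ | ⟨rfl, rfl⟩ | ⟨rfl, rfl⟩ :
        i = 0 ∧ j = 1 ∨ i = 0 ∧ j = 2 ∨ i = 1 ∧ j = 2 := by omega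
      · simpa using ⟨hvs, hvs.ne⟩
      · simpa using ⟨hwadj, hwv.symm⟩
      · simpa using ⟨hws.symm, hws.ne'⟩
    · obtain rfl | rfl : i = 1 ∨ i = 2 := by omega
      · simpa using hS s hs l (hLmem l hl).1
      · simpa using (hLmem l hl).2
    · split_ifs
      · exact fun h => hvS' (hLmem _ h).1
      · exact fun h => (hLmem _ h).2 hws
      · exact fun h => hwS (hLmem _ h).1
    · obtain rfl | rfl : i = 0 ∨ i = 1 := by omega
      · simpa using hfarv
      · simpa using hfarS s hs

/-- In a broom-free graph, a connected set containing a star with `2d` leaves is separated in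
a balanced way by the closed neighbourhood of few vertices. -/
theorem exists_separator [DecidableEq V] {X : Finset V} {d t : ℕ}
    (hG : ¬ (broom d t).IsIndContained G) (hX : G.ConnectedOn X)
    (hstar : ¬ G.StarFreeOn (2 * d) X) :
    ∃ Q ⊆ X, Q.Nonempty ∧ Q.card ≤ 2 * d + 1 + t ∧
      ∀ C, G.IsComponent (G.away X Q) C → 2 * C.card < X.card := by
  by_contra! hno
  simp only [StarFreeOn, not_forall, not_lt] at hstar
  obtain ⟨v, hv, S', hSX', hvS', hS', hcard'⟩ := hstar
  obtain ⟨S, hSS, hcard⟩ := Finset.exists_subset_card_eq hcard'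
  have hSX := hSS.trans hSX'
  -- Each round adds the end of the path to `Q`. As `Q` never exceeds the allowed size, the negated
  -- claim keeps supplying a component with at least half of `X`, into which the path is extended.
  have main : ∀ i ≤ t, ∃ Q C m p L, Q ⊆ X ∧ Q.Nonempty ∧ Q.card ≤ 2 * d + 1 + i ∧
      G.IsComponent (G.away X Q) C ∧ X.card ≤ 2 * C.card ∧ p m ∈ X ∧ i ≤ m ∧
      G.IsBroomAt d m p L C := by
    intro i
    induction i with
    | zero =>
      intro _
      have hQ : insert v S ⊆ X := Finset.insert_subset hv hSX
      have hQc : (insert v S).card ≤ 2 * d + 1 := (Finset.card_insert_le _ _).trans (by omega)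
      obtain ⟨C, hC, hCc⟩ := hno _ hQ (Finset.insert_nonempty _ _) (by omega)
      obtain ⟨m, p, L, hm, hb⟩ := exists_isBroomAt hX hv (fun s hs => hvS' s (hSS hs))
        (hS'.mono hSS) hcard hC
      exact ⟨_, C, m, p, L, hQ, Finset.insert_nonempty _ _, hQc, hC, hCc, hm, by omega, hb⟩
    | succ i ih =>
      intro hi
      obtain ⟨Q, C, m, p, L, hQX, hQ, hQc, hC, hCc, hm, him, hb⟩ := ih (by omega)
      have hQX' : insert (p m) Q ⊆ X := Finset.insert_subset hm hQX
      have hQc' := Finset.card_insert_le (p m) Q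
      obtain ⟨C', hC', hCc'⟩ := hno _ hQX' (Finset.insert_nonempty _ _) (by omega)
      obtain ⟨u, hu, hb'⟩ := hb.extend hQX hQ hC hCc hC' hCc'
      exact ⟨_, C', m + 1, _, L, hQX', Finset.insert_nonempty _ _, by omega, hC', hCc',
        by simpa using hu, by omega, hb'⟩
  obtain ⟨_, _, m, _, _, _, _, _, _, _, _, htm, hb⟩ := main t le_rfl
  exact hG (hb.isIndContained (by omega))

/-! ### Local search -/

/-- In a graph without stars with `2d` leaves, an independent set that cannot be enlarged by
adding a vertex, or by exchanging one vertex for two, is a `d`-approximation. -/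
theorem Indep.card_le_of_locally_maximal [DecidableEq V] {X I A : Finset V} {d : ℕ}
    (hX : G.StarFreeOn (2 * d) X) (hd : 1 ≤ d) (hI : G.Indep I) (hIX : I ⊆ X)
    (hmax : ∀ a ∈ X, a ∉ I → ¬ G.Indep (insert a I))
    (hswap : ∀ v ∈ I, ∀ a ∈ X, ∀ b ∈ X, a ∉ I → b ∉ I → a ≠ b →
      ¬ G.Indep (insert a (insert b (I.erase v))))
    (hA : G.Indep A) (hAX : A ⊆ X) : A.card ≤ d * I.card := by
  classical
  -- Equality is included so that vertices common to `A` and `I` count as meeting themselves.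
  let R : V → V → Prop := fun a i => a = i ∨ G.Adj a i
  let N : V → Finset V := fun a => I.filter (R a)
  have hN : ∀ a ∈ A, 1 ≤ (N a).card := by
    intro a ha
    rw [Nat.one_le_iff_ne_zero, Finset.card_ne_zero]
    by_cases haI : a ∈ I
    · exact ⟨a, Finset.mem_filter.2 ⟨haI, .inl rfl⟩⟩
    by_contra hne
    rw [Finset.not_nonempty_iff_eq_empty, Finset.filter_eq_empty_iff] at hne
    refine hmax a (hAX ha) haI fun x hx y hy hxy => ?_
    rcases Finset.mem_insert.1 hx with rfl | hx' <;> rcases Finset.mem_insert.1 hy with rfl | hy'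
    · exact G.irrefl hxy
    · exact hne hy' (.inr hxy)
    · exact hne hx' (.inr hxy.symm)
    · exact hI x hx' y hy' hxy
  -- Send such a vertex to its only partner in `I`. Two vertices with the same partner v could be
  -- exchanged for v, so the map is injective.
  have hone : (A.filter fun a => (N a).card = 1).card ≤ I.card := by
    have hex : ∀ a ∈ A.filter (fun a => (N a).card = 1), ∃ i, N a = {i} := fun a ha =>
      Finset.card_eq_one.1 (Finset.mem_filter.1 ha).2
    choose! f hf using hex
    have hfmem : ∀ a ∈ A.filter (fun a => (N a).card = 1), f a ∈ I ∧ R a (f a) := fun a ha =>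
      Finset.mem_filter.1 (hf a ha ▸ Finset.mem_singleton_self (f a) : f a ∈ N a)
    refine Finset.card_le_card_of_injOn f (fun a ha => (hfmem a ha).1) ?_
    intro a ha b hb hab
    by_contra hne
    have ha' := hfmem a ha
    have hb' := hfmem b hb
    have haA := (Finset.mem_filter.1 ha).1
    have hbA := (Finset.mem_filter.1 hb).1
    have huniq : ∀ c ∈ A.filter (fun a => (N a).card = 1), ∀ i ∈ I, R c i → i = f c := by
      intro c hc i hi hci
      have : i ∈ N c := Finset.mem_filter.2 ⟨hi, hci⟩
      rw [hf c hc] at this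
      exact Finset.mem_singleton.1 this
    have haI : a ∉ I := by
      intro haI
      have h₁ := huniq a ha a haI (.inl rfl)
      rcases hb'.2 with h₂ | h₂
      · exact hne (by rw [h₂, ← hab, ← h₁])
      · rw [← hab, ← h₁] at h₂
        exact hA b hbA a haA h₂
    have hbI : b ∉ I := by
      intro hbI
      have h₁ := huniq b hb b hbI (.inl rfl)
      rcases ha'.2 with h₂ | h₂
      · exact hne (by rw [h₂, hab, ← h₁])
      · rw [hab, ← h₁] at h₂
        exact hA a haA b hbA h₂
    have hnot : ∀ c ∈ A.filter (fun a => (N a).card = 1), f c = f a → ∀ i ∈ I.erase (f a),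
        ¬ G.Adj c i := by
      intro c hc hca i hi hci
      rw [Finset.mem_erase] at hi
      exact hi.1 ((huniq c hc i hi.2 (.inr hci)).trans hca)
    refine hswap (f a) ha'.1 a (hAX haA) b (hAX hbA) haI hbI hne fun x hx y hy hxy => ?_
    rw [Finset.mem_insert, Finset.mem_insert] at hx hy
    rcases hx with rfl | rfl | hx <;> rcases hy with rfl | rfl | hy
    · exact G.irrefl hxy
    · exact hA _ haA _ hbA hxy
    · exact hnot _ ha rfl y hy hxy
    · exact hA _ hbA _ haA hxy
    · exact G.irrefl hxy
    · exact hnot _ hb hab.symm y hy hxy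
    · exact hnot _ ha rfl x hx hxy.symm
    · exact hnot _ hb hab.symm x hx hxy.symm
    · exact hI x (Finset.mem_of_mem_erase hx) y (Finset.mem_of_mem_erase hy) hxy
  -- Every `a` meets `I` at least once; those that meet it exactly once are counted a second time.
  have hlow : 2 * A.card ≤ ∑ a ∈ A, (N a).card + (A.filter fun a => (N a).card = 1).card := by
    rw [Finset.card_filter, ← Finset.sum_add_distrib, mul_comm, ← smul_eq_mul,
      ← Finset.sum_const]
    refine Finset.sum_le_sum fun a ha => ?_
    have := hN a ha
    split_ifs <;> omega
  -- A vertex of `I` that lies in `A` is met only by itself; otherwise the vertices of `A` meeting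
  -- it are the leaves of a star around it.
  have hup : ∑ a ∈ A, (N a).card ≤ I.card * (2 * d - 1) := by
    have hdc := Finset.sum_card_bipartiteAbove_eq_sum_card_bipartiteBelow (s := A) (t := I) R
    change ∑ a ∈ A, (N a).card = _ at hdc
    rw [hdc, ← smul_eq_mul, ← Finset.sum_const]
    refine Finset.sum_le_sum fun i hi => ?_
    by_cases hiA : i ∈ A
    · have : Finset.bipartiteBelow R A i ⊆ {i} := by
        intro a ha
        rw [Finset.mem_bipartiteBelow] at ha
        rcases ha.2 with h | h
        · exact Finset.mem_singleton.2 h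
        · exact absurd h (hA a ha.1 i hiA)
      have := Finset.card_le_card this
      rw [Finset.card_singleton] at this
      omega
    · have hsub : Finset.bipartiteBelow R A i ⊆ A := Finset.filter_subset _ _
      have := hX i (hIX hi) (Finset.bipartiteBelow R A i) (hsub.trans hAX) (fun a ha => by
        rw [Finset.mem_bipartiteBelow] at ha
        rcases ha.2 with h | h
        · exact absurd (h ▸ ha.1) hiA
        · exact h.symm) (hA.mono hsub)
      omega
  have : I.card * (2 * d - 1) + I.card = 2 * (d * I.card) := by
    obtain ⟨k, rfl⟩ : ∃ k, d = k + 1 := ⟨d - 1, by omega⟩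
    rw [show 2 * (k + 1) - 1 = 2 * k + 1 by omega]; ring
  omega

end SimpleGraph

/-! ### The algorithm -/

namespace IndepSearch

open TreeLang

/-- Adjacency matrices. -/
abbrev Mat := List (List Bool)

/-- Adjacency of two vertices. -/
def adj (M : Mat) (i j : ℕ) : Bool := (M.getD i []).getD j false

/-- Membership of a vertex in a list. -/
def mem (l : List ℕ) (a : ℕ) : Bool := l.any fun b => b == a

/-- The elements of `Y` in `R` or adjacent to an element of `R`. -/
def grow (M : Mat) (Y R : List ℕ) : List ℕ :=
  Y.filter fun y => mem R y || R.any fun r => adj M r y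

/-- The component of `v` in `Y`. -/
def component (M : Mat) (Y : List ℕ) (v : ℕ) : List ℕ := (grow M Y)^[Y.length] [v]

/-- The elements of `X` outside the closed neighbourhood of `Q`. -/
def far (M : Mat) (X Q : List ℕ) : List ℕ :=
  X.filter fun u => Q.all fun w => !(w == u) && !(adj M w u)

/-- The elements of `X` in the closed neighbourhood of `Q`. -/
def near (M : Mat) (X Q : List ℕ) : List ℕ :=
  X.filter fun u => Q.any fun w => w == u || adj M w u

/-- Delete all occurrences of `v`. -/
def delete (X : List ℕ) (v : ℕ) : List ℕ := X.filter fun u => !(v == u)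

/-- The number of neighbours of `v` in `X`. -/
def deg (M : Mat) (X : List ℕ) (v : ℕ) : ℕ := (X.filter fun u => adj M v u).length

/-- All lists of `q` elements of `X`. -/
def tuples (X : List ℕ) : ℕ → List (List ℕ)
  | 0 => [[]]
  | q + 1 => X.flatMap fun a => (tuples X q).map fun T => a :: T

/-- Whether the closed neighbourhood of `Q` leaves only components with less than half of
the vertices of `X`. -/
def isSep (M : Mat) (X Q : List ℕ) : Bool :=
  (far M X Q).all fun y => decide (2 * (component M (far M X Q) y).length < X.length)

/-- Whether the list is free of repetitions and independent. -/
def indepList (M : Mat) : List ℕ → Bool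
  | [] => true
  | a :: l => (l.all fun b => !(a == b) && !(adj M a b)) && indepList M l

/-- The sets obtained from `I` by adding a vertex, or by exchanging one vertex for two. -/
def candidates (X I : List ℕ) : List (List ℕ) :=
  (X.map fun a => a :: I) ++
    X.flatMap fun a => X.flatMap fun b => X.map fun v => a :: b :: delete I v

/-- A larger independent set among the candidates, if there is one. -/
def improve (M : Mat) (X I : List ℕ) : List ℕ :=
  ((candidates X I).filter fun J => indepList M J && decide (I.length < J.length)).headD I

/-- Local search for a large independent set in `X`. -/
def localSearch (M : Mat) (X : List ℕ) : List ℕ := (improve M X)^[X.length] []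

/-- The arguments of the main recursion: the graph, the current vertex set, and the vertices to
branch on. -/
abbrev State := Mat × List ℕ × List ℕ

/-- The component of the first vertex. -/
def firstComponent (s : State) : List ℕ := component s.1 s.2.1 (s.2.1.headD 0)

/-- Whether to split the current graph along a component. -/
def isSplit (s : State) : Bool :=
  s.2.2.isEmpty && decide ((firstComponent s).length < s.2.1.length)

/-- The current vertices of large degree. -/
def heavy (s : State) : List ℕ :=
  s.2.1.filter fun v => decide (s.1.length < deg s.1 s.2.1 v * deg s.1 s.2.1 v)

/-- The separating `q`-tuples of the current graph. -/
def separators (q : ℕ) (s : State) : List (List ℕ) :=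
  (tuples s.2.1 q).filter fun Q => isSep s.1 s.2.1 Q

/-- The vertices to branch on: those left over from an earlier choice, or else a vertex of
large degree, or else the closed neighbourhood of a separating tuple. -/
def pivots (q : ℕ) (s : State) : List ℕ :=
  if s.2.2.isEmpty then
    if (heavy s).isEmpty then
      if (separators q s).isEmpty then [] else near s.1 s.2.1 ((separators q s).headD [])
    else [(heavy s).headD 0]
  else s.2.2

/-- The vertex to branch on. -/
def pivot (q : ℕ) (s : State) : ℕ := (pivots q s).headD 0

/-- Whether to stop the recursion. -/
def isLeaf (q : ℕ) (s : State) : Bool := !(isSplit s) && (pivots q s).isEmpty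

/-- The solution at a leaf of the recursion. -/
def base (s : State) : List ℕ := localSearch s.1 s.2.1

/-- First recursive call: the first component, or the graph without the pivot. -/
def left (q : ℕ) (s : State) : State :=
  if isSplit s then (s.1, firstComponent s, [])
  else (s.1, delete s.2.1 (pivot q s), delete (pivots q s) (pivot q s))

/-- Second recursive call: the other components, or the graph without the closed neighbourhood
of the pivot. -/
def right (q : ℕ) (s : State) : State :=
  if isSplit s then (s.1, s.2.1.filter fun u => !(mem (firstComponent s) u), [])
  else (s.1, far s.1 s.2.1 [pivot q s], far s.1 (pivots q s) [pivot q s])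

/-- Combination of the results of the two recursive calls. -/
def merge (q : ℕ) (r : State × List ℕ × List ℕ) : List ℕ :=
  if isSplit r.1 then r.2.1 ++ r.2.2
  else if decide (r.2.2.length < r.2.1.length) then r.2.1 else pivot q r.1 :: r.2.2

/-- The initial state. -/
def start (M : Mat) : State := (M, List.range M.length, [])

/-- The characteristic vector of a set of vertices. -/
def charVec (M : Mat) (r : List ℕ) : List Bool := (List.range M.length).map fun i => mem r i

/-! ### The steps of the algorithm take polynomial time -/

section PolyTime

variable {γ : Type} [Enc γ] {M : γ → Mat} {X Y Q I : γ → List ℕ} {v i j : γ → ℕ}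

@[fun_prop]
theorem polyTime_adj (hM : PolyTime M) (hi : PolyTime i) (hj : PolyTime j) :
    PolyTime fun c => adj (M c) (i c) (j c) := by
  unfold adj; fun_prop

@[fun_prop]
theorem polyTime_mem (hX : PolyTime X) (hi : PolyTime i) :
    PolyTime fun c => mem (X c) (i c) := by
  unfold mem; fun_prop

@[fun_prop]
theorem polyTime_grow (hM : PolyTime M) (hX : PolyTime X) (hY : PolyTime Y) :
    PolyTime fun c => grow (M c) (X c) (Y c) := by
  unfold grow; fun_prop

@[fun_prop]
theorem polyTime_component (hM : PolyTime M) (hY : PolyTime Y) (hv : PolyTime v) :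
    PolyTime fun c => component (M c) (Y c) (v c) := by
  refine PolyTime.iterate (g := fun c R => grow (M c) (Y c) R) (by fun_prop) (by fun_prop)
    (by fun_prop) ((PolyBdd.of_fst (α := ℕ) (hY.bdd.add
      (PolyTime.bdd (f := fun c => [v c]) (by fun_prop)))).mono fun p => ?_)
  obtain ⟨c, _ | n⟩ := p
  · simp
  · have := sz_le_of_subperm (List.filter_sublist (l := Y c)
      (p := fun y => mem ((grow (M c) (Y c))^[n] [v c]) y ||
        ((grow (M c) (Y c))^[n] [v c]).any fun r => adj (M c) r y)).subperm
    rw [Function.iterate_succ_apply']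
    exact this.trans (Nat.le_add_right _ _)

@[fun_prop]
theorem polyTime_far (hM : PolyTime M) (hX : PolyTime X) (hQ : PolyTime Q) :
    PolyTime fun c => far (M c) (X c) (Q c) := by
  unfold far; fun_prop

@[fun_prop]
theorem polyTime_near (hM : PolyTime M) (hX : PolyTime X) (hQ : PolyTime Q) :
    PolyTime fun c => near (M c) (X c) (Q c) := by
  unfold near; fun_prop

@[fun_prop]
theorem polyTime_delete (hX : PolyTime X) (hv : PolyTime v) :
    PolyTime fun c => delete (X c) (v c) := by
  unfold delete; fun_prop

@[fun_prop]
theorem polyTime_deg (hM : PolyTime M) (hX : PolyTime X) (hv : PolyTime v) :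
    PolyTime fun c => deg (M c) (X c) (v c) := by
  unfold deg; fun_prop

@[fun_prop]
theorem polyTime_tuples (hX : PolyTime X) (q : ℕ) : PolyTime fun c => tuples (X c) q := by
  induction q with
  | zero => unfold tuples; fun_prop
  | succ q ih =>
    have ih' : PolyTime fun p : γ × ℕ => tuples (X p.1) q := ih.comp (f := Prod.fst) (by fun_prop)
    unfold tuples
    exact .flatMap hX (.map ih' (by fun_prop))

@[fun_prop]
theorem polyTime_isSep (hM : PolyTime M) (hX : PolyTime X) (hQ : PolyTime Q) :
    PolyTime fun c => isSep (M c) (X c) (Q c) := by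
  unfold isSep; fun_prop

@[fun_prop]
theorem polyTime_indepList (hM : PolyTime M) (hI : PolyTime I) :
    PolyTime fun c => indepList (M c) (I c) := by
  have : PolyTime fun p : Mat × List ℕ => indepList p.1 p.2 :=
    PolyTime.listRec (b := fun _ => true)
      (s := fun q => (q.2.2.1.all fun b => !(q.2.1 == b) && !(adj q.1 q.2.1 b)) && q.2.2.2)
      (by fun_prop) (by fun_prop) (.of_bool _) (fun c => rfl) (fun c a l => rfl)
  exact this.comp (hM.pair hI)

@[fun_prop]
theorem polyTime_candidates (hX : PolyTime X) (hI : PolyTime I) :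
    PolyTime fun c => candidates (X c) (I c) := by
  unfold candidates; fun_prop

@[fun_prop]
theorem polyTime_improve (hM : PolyTime M) (hX : PolyTime X) (hI : PolyTime I) :
    PolyTime fun c => improve (M c) (X c) (I c) := by
  unfold improve; fun_prop

end PolyTime

end IndepSearch

/-! ### Correctness of the steps -/

namespace IndepSearch

open TreeLang

theorem mem_eq_true {l : List ℕ} {a : ℕ} : mem l a = true ↔ a ∈ l := by
  simp [mem]

theorem toFinset_subset_toFinset {l l' : List ℕ} (h : l ⊆ l') : l.toFinset ⊆ l'.toFinset :=
  fun _ ha => List.mem_toFinset.2 (h (List.mem_toFinset.1 ha))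

theorem mem_delete {X : List ℕ} {u v : ℕ} : u ∈ delete X v ↔ u ∈ X ∧ v ≠ u := by
  simp [delete]

theorem mem_tuples {X : List ℕ} {q : ℕ} {T : List ℕ} :
    T ∈ tuples X q ↔ T.length = q ∧ ∀ a ∈ T, a ∈ X := by
  induction q generalizing T with
  | zero =>
    simp only [tuples, List.mem_singleton, List.length_eq_zero_iff]
    constructor
    · rintro rfl; simp
    · exact fun h => h.1
  | succ q ih =>
    simp only [tuples, List.mem_flatMap, List.mem_map, ih]
    constructor
    · rintro ⟨a, ha, T, ⟨rfl, hT⟩, rfl⟩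
      simpa using ⟨ha, hT⟩
    · rcases T with _ | ⟨a, T⟩
      · simp
      · intro h
        simp only [List.length_cons, Nat.add_right_cancel_iff, List.mem_cons, forall_eq_or_imp] at h
        exact ⟨a, h.2.1, T, ⟨h.1, h.2.2⟩, rfl⟩

/-- Tuples have length exactly `q`, so a smaller set is padded by repeating one of its elements;
hence it must be nonempty. -/
theorem exists_tuple {X : List ℕ} {Q : Finset ℕ} {q : ℕ} (hQ : Q.Nonempty) (hQX : Q ⊆ X.toFinset)
    (hcard : Q.card ≤ q) : ∃ T ∈ tuples X q, T.toFinset = Q := by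
  obtain ⟨a, ha⟩ := hQ
  refine ⟨Q.toList ++ List.replicate (q - Q.card) a, mem_tuples.2 ⟨by simp; omega, ?_⟩, ?_⟩
  · intro b hb
    have : b ∈ Q := by
      rcases List.mem_append.1 hb with hb | hb
      · simpa using hb
      · rwa [List.eq_of_mem_replicate hb]
    simpa using hQX this
  · ext b
    simp only [List.toFinset_append, Finset.toList_toFinset, Finset.mem_union, List.mem_toFinset]
    refine or_iff_left_of_imp fun hb => ?_
    rwa [List.eq_of_mem_replicate hb]

/-- `M` is the adjacency matrix of `G`. -/
def Represents (M : Mat) (G : SimpleGraph ℕ) : Prop := ∀ i j, adj M i j = true ↔ G.Adj i j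

variable {M : Mat} {G : SimpleGraph ℕ}

theorem Represents.adj_eq_false (hM : Represents M G) {i j : ℕ} :
    adj M i j = false ↔ ¬ G.Adj i j := by
  rw [← hM, Bool.not_eq_true]

/-! #### Components -/

theorem mem_grow (hM : Represents M G) {Y R : List ℕ} {y : ℕ} :
    y ∈ grow M Y R ↔ y ∈ Y ∧ (y ∈ R ∨ ∃ r ∈ R, G.Adj r y) := by
  simp [grow, mem_eq_true, hM _ _]

theorem nodup_iterate_grow {Y : List ℕ} (hY : Y.Nodup) (v n : ℕ) :
    ((grow M Y)^[n] [v]).Nodup := by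
  cases n with
  | zero => simp
  | succ n => rw [Function.iterate_succ_apply']; exact hY.filter _

theorem iterate_grow_subset {Y : List ℕ} {v : ℕ} (hv : v ∈ Y) (n : ℕ) :
    (grow M Y)^[n] [v] ⊆ Y := by
  cases n with
  | zero => simpa using hv
  | succ n => rw [Function.iterate_succ_apply']; exact List.filter_subset_self Y

theorem mem_iterate_grow (hM : Represents M G) {Y : List ℕ} {v : ℕ} (hv : v ∈ Y) (n : ℕ) :
    v ∈ (grow M Y)^[n] [v] := by
  induction n with
  | zero => simp
  | succ n ih => rw [Function.iterate_succ_apply', mem_grow hM]; exact ⟨hv, .inl ih⟩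

theorem iterate_grow_subset_of_closedIn (hM : Represents M G) {Y : List ℕ} {v : ℕ} {A : Finset ℕ}
    (hv : v ∈ A) (hA : G.ClosedIn Y.toFinset A) (n : ℕ) :
    ∀ u ∈ (grow M Y)^[n] [v], u ∈ A := by
  induction n with
  | zero => simpa using hv
  | succ n ih =>
    intro u hu
    rw [Function.iterate_succ_apply', mem_grow hM] at hu
    rcases hu.2 with h | ⟨r, hr, hru⟩
    · exact ih u h
    · exact hA r (ih r hr) u (by simpa using hu.1) hru

/-- Every round of `grow` adds a vertex unless the set is already closed. If it were still not
closed after `Y.length` rounds, it would have more distinct vertices than `Y`. -/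
theorem closedIn_component (hM : Represents M G) {Y : List ℕ} (hY : Y.Nodup) {v : ℕ}
    (hv : v ∈ Y) : G.ClosedIn Y.toFinset (component M Y v).toFinset := by
  have key : ∀ n, G.ClosedIn Y.toFinset ((grow M Y)^[n] [v]).toFinset ∨
      n + 1 ≤ ((grow M Y)^[n] [v]).length := by
    intro n
    induction n with
    | zero => simp
    | succ n ih =>
      set R := (grow M Y)^[n] [v] with hR
      rw [Function.iterate_succ_apply', ← hR]
      have hsub : R ⊆ grow M Y R := fun u hu =>
        (mem_grow hM).2 ⟨iterate_grow_subset hv n hu, .inl hu⟩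
      by_cases hcl : G.ClosedIn Y.toFinset R.toFinset
      · left
        have : (grow M Y R).toFinset = R.toFinset := by
          refine Finset.Subset.antisymm (fun u hu => ?_) (toFinset_subset_toFinset hsub)
          rw [List.mem_toFinset, mem_grow hM] at hu
          rcases hu.2 with h | ⟨r, hr, hru⟩
          · simpa using h
          · exact hcl r (by simpa using hr) u (by simpa using hu.1) hru
        rwa [this]
      · right
        have hlen := ih.resolve_left hcl
        simp only [SimpleGraph.ClosedIn, not_forall] at hcl
        obtain ⟨a, ha, y, hy, hay, hyR⟩ := hcl
        rw [List.mem_toFinset] at ha hy hyR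
        have hnd : (y :: R).Nodup := List.nodup_cons.2 ⟨hyR, nodup_iterate_grow hY v n⟩
        have := (hnd.subperm (l₂ := grow M Y R) (List.cons_subset.2
          ⟨(mem_grow hM).2 ⟨hy, .inr ⟨a, ha, hay⟩⟩, hsub⟩)).length_le
        rw [List.length_cons] at this
        omega
  refine (key Y.length).resolve_right fun h => ?_
  have := ((nodup_iterate_grow (M := M) hY v Y.length).subperm
    (iterate_grow_subset hv Y.length)).length_le
  omega

theorem component_subset {Y : List ℕ} {v : ℕ} (hv : v ∈ Y) : component M Y v ⊆ Y :=
  iterate_grow_subset hv _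

theorem nodup_component {Y : List ℕ} (hY : Y.Nodup) (v : ℕ) : (component M Y v).Nodup :=
  nodup_iterate_grow hY v _

theorem mem_component_self (hM : Represents M G) {Y : List ℕ} {v : ℕ} (hv : v ∈ Y) :
    v ∈ component M Y v := mem_iterate_grow hM hv _

/-- The set is the least closed set containing `v`. A subset closed in it is closed in `Y`, so it is
everything if it contains `v`; if not, its complement is closed by symmetry and contains `v`, so the
subset is empty. -/
theorem isComponent_component (hM : Represents M G) {Y : List ℕ} (hY : Y.Nodup) {v : ℕ}
    (hv : v ∈ Y) : G.IsComponent Y.toFinset (component M Y v).toFinset := by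
  have hcl := closedIn_component hM hY hv
  have hself := mem_component_self hM hv
  have hmin : ∀ A : Finset ℕ, v ∈ A → G.ClosedIn Y.toFinset A →
      ∀ u ∈ component M Y v, u ∈ A := fun A hvA hA => iterate_grow_subset_of_closedIn hM hvA hA _
  refine ⟨toFinset_subset_toFinset (component_subset hv), ⟨v, by simpa using hself⟩,
    fun A hA hne hAcl => ?_, hcl⟩
  have hA' : G.ClosedIn Y.toFinset A := fun a ha y hy hay =>
    hAcl a ha y (hcl a (hA ha) y hy hay) hay
  refine Finset.Subset.antisymm hA fun u hu => ?_
  by_cases hvA : v ∈ A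
  · exact hmin A hvA hA' u (by simpa using hu)
  · exfalso
    obtain ⟨a, ha⟩ := hne
    have := hmin ((component M Y v).toFinset \ A) (by simpa using ⟨hself, hvA⟩)
      (fun b hb y hy hby => ?_) a (by simpa using hA ha)
    · exact (Finset.mem_sdiff.1 this).2 ha
    · rw [Finset.mem_sdiff] at hb ⊢
      have hyC := hcl b hb.1 y hy hby
      exact ⟨hyC, fun hyA => hb.2 (hAcl y hyA b hb.1 hby.symm)⟩

theorem mem_far (hM : Represents M G) {X Q : List ℕ} {u : ℕ} :
    u ∈ far M X Q ↔ u ∈ X ∧ ∀ w ∈ Q, w ≠ u ∧ ¬ G.Adj w u := by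
  simp [far, hM.adj_eq_false]

theorem mem_near (hM : Represents M G) {X Q : List ℕ} {u : ℕ} :
    u ∈ near M X Q ↔ u ∈ X ∧ ∃ w ∈ Q, w = u ∨ G.Adj w u := by
  simp [near, hM _ _]

theorem toFinset_far (hM : Represents M G) (X Q : List ℕ) :
    (far M X Q).toFinset = G.away X.toFinset Q.toFinset := by
  ext u
  simp [mem_far hM, SimpleGraph.mem_away]

theorem isSep_eq_true (hM : Represents M G) {X : List ℕ} (hX : X.Nodup) (Q : List ℕ) :
    isSep M X Q = true ↔
      ∀ C, G.IsComponent (G.away X.toFinset Q.toFinset) C → 2 * C.card < X.length := by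
  have hnd : (far M X Q).Nodup := hX.filter _
  rw [← toFinset_far hM]
  simp only [isSep, List.all_eq_true, decide_eq_true_eq]
  constructor
  · intro h C hC
    obtain ⟨y, hy⟩ := hC.nonempty
    have hy' : y ∈ far M X Q := by simpa using hC.subset hy
    have hcomp := isComponent_component hM hnd hy'
    have hsub := hcomp.subset_of_inter hC (Finset.Subset.refl _)
      ⟨y, Finset.mem_inter.2 ⟨hy, by simpa using mem_component_self hM hy'⟩⟩
    have := (Finset.card_le_card hsub).trans (List.toFinset_card_le _)
    have := h y hy'
    omega
  · intro h y hy
    have := h _ (isComponent_component hM hnd hy)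
    rwa [List.toFinset_card_of_nodup (nodup_component hnd y)] at this

/-! #### Local search -/

theorem indepList_eq_true (hM : Represents M G) {l : List ℕ} :
    indepList M l = true ↔ l.Nodup ∧ G.Indep l.toFinset := by
  induction l with
  | nil => simp [indepList, SimpleGraph.Indep]
  | cons a l ih =>
    simp only [indepList, Bool.and_eq_true, List.all_eq_true, ih, List.nodup_cons,
      SimpleGraph.Indep, List.mem_toFinset, List.mem_cons, Bool.not_eq_true', beq_eq_false_iff_ne,
      hM.adj_eq_false]
    constructor
    · rintro ⟨h₁, h₂, h₃⟩
      refine ⟨⟨fun h => (h₁ a h).1 rfl, h₂⟩, ?_⟩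
      rintro x (rfl | hx) y (rfl | hy)
      · exact G.irrefl
      · exact (h₁ y hy).2
      · exact fun h => (h₁ x hx).2 h.symm
      · exact h₃ x hx y hy
    · rintro ⟨⟨h₁, h₂⟩, h₃⟩
      exact ⟨fun b hb => ⟨fun h => h₁ (h ▸ hb), h₃ a (.inl rfl) b (.inr hb)⟩, h₂,
        fun x hx y hy => h₃ x (.inr hx) y (.inr hy)⟩

theorem nodup_of_indepList {l : List ℕ} (h : indepList M l = true) : l.Nodup := by
  induction l with
  | nil => simp
  | cons a l ih =>
    simp only [indepList, Bool.and_eq_true, List.all_eq_true, Bool.not_eq_true',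
      beq_eq_false_iff_ne] at h
    exact List.nodup_cons.2 ⟨fun ha => (h.1 a ha).1 rfl, ih h.2⟩

theorem subset_of_mem_candidates {X I J : List ℕ} (hI : I ⊆ X) (hJ : J ∈ candidates X I) :
    J ⊆ X := by
  simp only [candidates, List.mem_append, List.mem_map, List.mem_flatMap] at hJ
  rcases hJ with ⟨a, ha, rfl⟩ | ⟨a, ha, b, hb, v, -, rfl⟩
  · exact List.cons_subset.2 ⟨ha, hI⟩
  · exact List.cons_subset.2 ⟨ha, List.cons_subset.2 ⟨hb, fun u hu => hI (mem_delete.1 hu).1⟩⟩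

theorem improve_spec (M : Mat) (X I : List ℕ) :
    (improve M X I = I ∧ ∀ J ∈ candidates X I, indepList M J = true → J.length ≤ I.length) ∨
    (improve M X I ∈ candidates X I ∧ indepList M (improve M X I) = true ∧
      I.length < (improve M X I).length) := by
  rcases h : (candidates X I).filter fun J => indepList M J && decide (I.length < J.length)
    with _ | ⟨J, l⟩
  · left
    refine ⟨by simp [improve, h], fun J hJ hJ' => ?_⟩
    rw [List.filter_eq_nil_iff] at h
    have := h J hJ
    simpa [hJ'] using this
  · right
    have hJ : J ∈ (candidates X I).filter fun J =>
        indepList M J && decide (I.length < J.length) := by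
      simp [h]
    have heq : improve M X I = J := by simp [improve, h]
    rw [List.mem_filter, Bool.and_eq_true, decide_eq_true_eq] at hJ
    rw [heq]
    exact hJ

/-- A round that changes the set enlarges it, so after `n` rounds the search is stuck or has `n`
vertices. With `n = X.length` it must be stuck, as no independent list in `X` is longer. -/
theorem iterate_improve_spec (M : Mat) (X : List ℕ) (n : ℕ) :
    (improve M X)^[n] [] ⊆ X ∧ indepList M ((improve M X)^[n] []) = true ∧
      (improve M X ((improve M X)^[n] []) = (improve M X)^[n] [] ∨
        n ≤ ((improve M X)^[n] []).length) := by
  induction n with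
  | zero => simp [indepList]
  | succ n ih =>
    rw [Function.iterate_succ_apply']
    set I := (improve M X)^[n] []
    obtain ⟨h₁, h₂, h₃⟩ := ih
    rcases improve_spec M X I with ⟨h, -⟩ | ⟨h, h', h''⟩
    · rw [h]
      exact ⟨h₁, h₂, .inl h⟩
    · refine ⟨subset_of_mem_candidates h₁ h, h', .inr ?_⟩
      rcases h₃ with h₃ | h₃
      · rw [h₃] at h''; omega
      · omega

theorem localSearch_subset (M : Mat) (X : List ℕ) : localSearch M X ⊆ X :=
  (iterate_improve_spec M X _).1

theorem indepList_localSearch (M : Mat) (X : List ℕ) : indepList M (localSearch M X) = true :=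
  (iterate_improve_spec M X _).2.1

theorem improve_localSearch (M : Mat) (X : List ℕ) :
    ∀ J ∈ candidates X (localSearch M X), indepList M J = true →
      J.length ≤ (localSearch M X).length := by
  rcases improve_spec M X (localSearch M X) with ⟨-, h⟩ | ⟨h, h', h''⟩
  · exact h
  · exfalso
    have hlen := ((nodup_of_indepList h').subperm
      (subset_of_mem_candidates (localSearch_subset M X) h)).length_le
    rcases (iterate_improve_spec M X X.length).2.2 with h₃ | h₃
    · change improve M X (localSearch M X) = localSearch M X at h₃
      rw [h₃] at h''; omega
    · change X.length ≤ (localSearch M X).length at h₃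
      omega

theorem card_le_localSearch (hM : Represents M G) {X : List ℕ} {d : ℕ} (hd : 1 ≤ d)
    (hX : G.StarFreeOn (2 * d) X.toFinset) {A : Finset ℕ} (hA : G.Indep A)
    (hAX : A ⊆ X.toFinset) : A.card ≤ d * (localSearch M X).length := by
  set I := localSearch M X with hI
  obtain ⟨hnd, hind⟩ := (indepList_eq_true hM).1 (indepList_localSearch M X)
  have himp := improve_localSearch M X
  rw [← hI] at hnd hind himp
  rw [← List.toFinset_card_of_nodup hnd]
  refine SimpleGraph.Indep.card_le_of_locally_maximal hX hd hind
    (toFinset_subset_toFinset (localSearch_subset M X)) ?_ ?_ hA hAX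
  · intro a ha haI hind'
    rw [List.mem_toFinset] at ha haI
    have := himp (a :: I) (by simpa [candidates] using .inl ha)
      ((indepList_eq_true hM).2 ⟨List.nodup_cons.2 ⟨haI, hnd⟩, by simpa using hind'⟩)
    simp at this
  · intro v hv a ha b hb haI hbI hab hind'
    rw [List.mem_toFinset] at hv ha hb haI hbI
    have hvX : v ∈ X := localSearch_subset M X hv
    have hdel : delete I v = I.erase v := by
      rw [hnd.erase_eq_filter, delete]
      congr 1; ext u; simp [bne, eq_comm]
    have hlen : (I.erase v).length + 1 = I.length := by
      rw [List.length_erase_of_mem hv]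
      have := List.length_pos_of_mem hv
      omega
    have hset : (a :: b :: delete I v).toFinset = insert a (insert b (I.toFinset.erase v)) := by
      ext u; simp [mem_delete, and_comm, eq_comm]
    have := himp (a :: b :: delete I v)
      (List.mem_append.2 (.inr (by simpa using ⟨ha, hb, v, hvX, rfl⟩)))
      ((indepList_eq_true hM).2 ⟨?_, by rw [hset]; exact hind'⟩)
    · rw [hdel] at this
      simp only [List.length_cons] at this
      omega
    · refine List.nodup_cons.2 ⟨?_, List.nodup_cons.2 ⟨fun h => hbI (mem_delete.1 h).1,
        hnd.filter _⟩⟩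
      rw [List.mem_cons, not_or]
      exact ⟨hab, fun h => haI (mem_delete.1 h).1⟩

/-! #### The remaining steps take polynomial time -/

section PolyTime

variable {γ : Type} [Enc γ] {N : γ → Mat} {X : γ → List ℕ} {s : γ → State}

@[fun_prop]
theorem polyTime_localSearch (hN : PolyTime N) (hX : PolyTime X) :
    PolyTime fun c => localSearch (N c) (X c) := by
  refine PolyTime.iterate (g := fun c I => improve (N c) (X c) I) (by fun_prop) (by fun_prop)
    (by fun_prop) ((PolyBdd.of_fst (α := ℕ) hX.bdd).mono fun p => ?_)
  obtain ⟨h₁, h₂, -⟩ := iterate_improve_spec (N p.1) (X p.1) p.2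
  exact sz_le_of_subperm ((nodup_of_indepList h₂).subperm h₁)

@[fun_prop]
theorem polyTime_firstComponent (hs : PolyTime s) : PolyTime fun c => firstComponent (s c) := by
  unfold firstComponent; fun_prop

@[fun_prop]
theorem polyTime_isSplit (hs : PolyTime s) : PolyTime fun c => isSplit (s c) := by
  unfold isSplit; fun_prop

@[fun_prop]
theorem polyTime_heavy (hs : PolyTime s) : PolyTime fun c => heavy (s c) := by
  unfold heavy; fun_prop

@[fun_prop]
theorem polyTime_separators (q : ℕ) (hs : PolyTime s) :
    PolyTime fun c => separators q (s c) := by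
  unfold separators; fun_prop

@[fun_prop]
theorem polyTime_pivots (q : ℕ) (hs : PolyTime s) : PolyTime fun c => pivots q (s c) := by
  unfold pivots; fun_prop

@[fun_prop]
theorem polyTime_pivot (q : ℕ) (hs : PolyTime s) : PolyTime fun c => pivot q (s c) := by
  unfold pivot; fun_prop

theorem polyTime_isLeaf (q : ℕ) : PolyTime (isLeaf q) := by
  unfold isLeaf; fun_prop

theorem polyTime_base : PolyTime base := by
  unfold base; fun_prop

theorem polyTime_left (q : ℕ) : PolyTime (left q) := by
  unfold left; fun_prop

theorem polyTime_right (q : ℕ) : PolyTime (right q) := by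
  unfold right; fun_prop

theorem polyTime_merge (q : ℕ) : PolyTime (merge q) := by
  unfold merge; fun_prop

theorem polyTime_start : PolyTime start := by
  unfold start; fun_prop

theorem polyTime_charVec : PolyTime fun p : Mat × List ℕ => charVec p.1 p.2 := by
  unfold charVec; fun_prop

end PolyTime

end IndepSearch

/-! ### Analysis of the recursion -/

namespace IndepSearch

open TreeLang

variable {M : Mat} {G : SimpleGraph ℕ}

/-- All components of the subgraph induced by `Y` have at most `h` vertices. -/
def ComponentsLE (G : SimpleGraph ℕ) (Y : Finset ℕ) (h : ℕ) : Prop :=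
  ∀ C, G.IsComponent Y C → C.card ≤ h

/-- The component of `Y` around a given vertex is obtained from `component`; this is the only role
of the matrix. -/
theorem ComponentsLE.mono (hM : Represents M G) {Y Y' : Finset ℕ} {h : ℕ}
    (hY : ComponentsLE G Y h) (hsub : Y' ⊆ Y) : ComponentsLE G Y' h := by
  intro C hC
  obtain ⟨y, hy⟩ := hC.nonempty
  have hy' : y ∈ Y.toList := by simpa using hsub (hC.subset hy)
  have hD := isComponent_component hM Y.nodup_toList hy'
  rw [Finset.toList_toFinset] at hD
  refine (Finset.card_le_card (hD.subset_of_inter hC hsub ⟨y, ?_⟩)).trans (hY _ hD)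
  exact Finset.mem_inter.2 ⟨hy, by simpa using mem_component_self hM hy'⟩

theorem componentsLE_length (G : SimpleGraph ℕ) {X : List ℕ} {h : ℕ} (Y : Finset ℕ)
    (hY : Y ⊆ X.toFinset) (hX : X.length ≤ h) : ComponentsLE G Y h := fun _ hC =>
  (Finset.card_le_card (hC.subset.trans hY)).trans ((List.toFinset_card_le _).trans hX)

/-! #### The bound for the number of leaves -/

/-- A bound for the number of leaves of the recursion on a graph with `x` vertices and components
of size at most `h`. -/
def leafBound (Δ K x h : ℕ) : ℕ := max x 1 * (x + 1) ^ (x / Δ) * (h + 1) ^ K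

theorem leafBound_pos (Δ K x h : ℕ) : 1 ≤ leafBound Δ K x h := by
  unfold leafBound
  exact Nat.succ_le_of_lt (by positivity)

theorem leafBound_mono {Δ K x y h h' : ℕ} (hxy : x ≤ y) (hh : h ≤ h') :
    leafBound Δ K x h ≤ leafBound Δ K y h' := by
  unfold leafBound
  have : (x + 1) ^ (x / Δ) ≤ (y + 1) ^ (y / Δ) :=
    (Nat.pow_le_pow_left (by omega) _).trans
      (Nat.pow_le_pow_right (by omega) (Nat.div_le_div_right hxy))
  gcongr

/-- Pays for splitting: the factor `max x 1` is additive on positive numbers and the other factors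
are monotone. -/
theorem leafBound_add {Δ K a b h : ℕ} (ha : 1 ≤ a) (hb : 1 ≤ b) :
    leafBound Δ K a h + leafBound Δ K b h ≤ leafBound Δ K (a + b) h := by
  unfold leafBound
  have h₁ : (a + 1) ^ (a / Δ) ≤ (a + b + 1) ^ ((a + b) / Δ) :=
    (Nat.pow_le_pow_left (by omega) _).trans
      (Nat.pow_le_pow_right (by omega) (Nat.div_le_div_right (by omega)))
  have h₂ : (b + 1) ^ (b / Δ) ≤ (a + b + 1) ^ ((a + b) / Δ) :=
    (Nat.pow_le_pow_left (by omega) _).trans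
      (Nat.pow_le_pow_right (by omega) (Nat.div_le_div_right (by omega)))
  rw [max_eq_left ha, max_eq_left hb, max_eq_left (by omega), ← add_mul, add_mul a b]
  gcongr

/-- Pays for branching on a vertex of large degree. Losing Δ vertices lowers the exponent x/Δ = j+1
by one, and x^{j+1} + (x+1)^j ≤ (x+1)^{j+1}. -/
theorem leafBound_branch {Δ K x y h : ℕ} (hΔ : 1 ≤ Δ) (hx : y + Δ ≤ x) :
    leafBound Δ K (x - 1) h + leafBound Δ K y h ≤ leafBound Δ K x h := by
  obtain ⟨j, hj⟩ : ∃ j, x / Δ = j + 1 := by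
    have : 1 ≤ x / Δ := (Nat.le_div_iff_mul_le (by omega)).2 (by omega)
    exact ⟨x / Δ - 1, by omega⟩
  have h₁ : (x - 1 + 1) ^ ((x - 1) / Δ) ≤ x ^ (j + 1) := by
    rw [Nat.sub_add_cancel (by omega), ← hj]
    exact Nat.pow_le_pow_right (by omega) (Nat.div_le_div_right (by omega))
  have h₂ : (y + 1) ^ (y / Δ) ≤ (x + 1) ^ j := by
    have : y / Δ ≤ j := by
      have := Nat.div_le_div_right (c := Δ) hx
      rw [Nat.add_div_right _ (by omega), hj] at this
      omega
    exact (Nat.pow_le_pow_left (by omega) _).trans (Nat.pow_le_pow_right (by omega) this)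
  have h₃ : x ^ (j + 1) + (x + 1) ^ j ≤ (x + 1) ^ (j + 1) := by
    have : x ^ j ≤ (x + 1) ^ j := Nat.pow_le_pow_left (by omega) _
    rw [pow_succ, pow_succ]
    nlinarith
  unfold leafBound
  rw [hj, ← add_mul]
  refine Nat.mul_le_mul_right _ ?_
  calc max (x - 1) 1 * (x - 1 + 1) ^ ((x - 1) / Δ) + max y 1 * (y + 1) ^ (y / Δ)
      ≤ max x 1 * x ^ (j + 1) + max x 1 * (x + 1) ^ j := by
        gcongr <;> omega
    _ = max x 1 * (x ^ (j + 1) + (x + 1) ^ j) := by ring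
    _ ≤ _ := Nat.mul_le_mul_left _ h₃

/-- Pays for branching on a separator: since 2(h+1) ≤ x+1, halving the components gains a factor 2
in each of the `K` factors h+1. -/
theorem leafBound_separator {Δ K x h z : ℕ} (hz : z ≤ K) (hh : 2 * h < x) :
    2 ^ z * leafBound Δ K x h ≤ leafBound Δ K x x := by
  unfold leafBound
  calc 2 ^ z * (max x 1 * (x + 1) ^ (x / Δ) * (h + 1) ^ K)
      ≤ 2 ^ K * (max x 1 * (x + 1) ^ (x / Δ) * (h + 1) ^ K) := by
        gcongr; omega
    _ = max x 1 * (x + 1) ^ (x / Δ) * (2 * (h + 1)) ^ K := by rw [mul_pow]; ring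
    _ ≤ _ := by gcongr; omega

/-! #### The cases of the recursion -/

/-- The recursion started with the vertex set `X` and the branching vertices `Z` finds
a `d`-approximation in `X`, and has at most `B` leaves. -/
def Solves (M : Mat) (G : SimpleGraph ℕ) (d q S : ℕ) (X Z : List ℕ) (B : ℕ) : Prop :=
  ∃ r m, RecTree (isLeaf q) base (left q) (right q) (merge q) S (M, X, Z) r m ∧
    r ⊆ X ∧ indepList M r = true ∧ sz r ≤ S ∧
    (∀ A, G.Indep A → A ⊆ X.toFinset → A.card ≤ d * r.length) ∧ m ≤ B

/-- A list of vertices without repetitions. -/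
def Valid (M : Mat) (X : List ℕ) : Prop := X.Nodup ∧ ∀ a ∈ X, a < M.length

theorem Valid.subset {X Y : List ℕ} (hX : Valid M X) (hY : Y.Nodup) (h : Y ⊆ X) : Valid M Y :=
  ⟨hY, fun a ha => hX.2 a (h ha)⟩

theorem Valid.filter {X : List ℕ} (hX : Valid M X) (p : ℕ → Bool) : Valid M (X.filter p) :=
  hX.subset (hX.1.filter p) (List.filter_subset_self X)

/-- A bound for the sizes of the lists of vertices. -/
def listBound (M : Mat) : ℕ := 1 + M.length * (2 * M.length + 1)

theorem Valid.sz_le {X : List ℕ} (hX : Valid M X) : sz X ≤ listBound M := by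
  have hlen : X.length ≤ M.length := by
    have := (hX.1.subperm (l₂ := List.range M.length) fun a ha =>
      List.mem_range.2 (hX.2 a ha)).length_le
    simpa using this
  refine (sz_le_of_forall (s := 2 * M.length) fun a ha => ?_).trans ?_
  · rw [sz_nat]
    have := hX.2 a ha
    omega
  · unfold listBound; gcongr

/-- A bound for the sizes of the states. -/
noncomputable def stateBound (M : Mat) : ℕ := sz M + 2 * listBound M + 2

theorem sz_state_le {X Z : List ℕ} (hX : Valid M X) (hZ : Valid M Z) :
    sz ((M, X, Z) : State) ≤ stateBound M := by
  have := hX.sz_le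
  have := hZ.sz_le
  rw [sz_prod, sz_prod]
  unfold stateBound
  omega

variable {d q : ℕ} {X Z : List ℕ}

theorem solves_leaf (hM : Represents M G) (hd : 1 ≤ d) (hX : Valid M X) (hZ : Valid M Z)
    (hleaf : isLeaf q (M, X, Z) = true) (hstar : G.StarFreeOn (2 * d) X.toFinset) :
    Solves M G d q (stateBound M) X Z 1 := by
  have hval : Valid M (localSearch M X) :=
    hX.subset (nodup_of_indepList (indepList_localSearch M X)) (localSearch_subset M X)
  refine ⟨base (M, X, Z), 1, .leaf hleaf (sz_state_le hX hZ), localSearch_subset M X,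
    indepList_localSearch M X, ?_, fun A hA hAX => card_le_localSearch hM hd hstar hA hAX, le_rfl⟩
  have := hval.sz_le
  change sz (localSearch M X) ≤ _
  unfold stateBound; omega

/-- If A avoids `z`, the first call approximates it. If A contains `z`, the second call approximates
A without `z`, and adding `z` gains 1 on one side and d ≥ 1 on the other. -/
theorem solves_pivot (hM : Represents M G) (hd : 1 ≤ d) (hX : Valid M X) (hZ : Valid M Z)
    (hsplit : isSplit (M, X, Z) = false) {z : ℕ} {Z' : List ℕ} (hp : pivots q (M, X, Z) = Z')
    (hz : Z'.head? = some z) (hzX : z ∈ X) {B₁ B₂ : ℕ}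
    (h₁ : Solves M G d q (stateBound M) (delete X z) (delete Z' z) B₁)
    (h₂ : Solves M G d q (stateBound M) (far M X [z]) (far M Z' [z]) B₂) :
    Solves M G d q (stateBound M) X Z (B₁ + B₂) := by
  obtain ⟨a, m, hta, ha, haI, hsa, hAa, hm⟩ := h₁
  obtain ⟨b, n, htb, hb, hbI, hsb, hAb, hn⟩ := h₂
  have hpz : pivot q (M, X, Z) = z := by simp [pivot, hp, List.headD_eq_head?_getD, hz]
  have hne : Z'.isEmpty = false := by
    cases Z' with
    | nil => simp at hz
    | cons => rfl
  have hleaf : isLeaf q (M, X, Z) = false := by simp [isLeaf, hp, hne]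
  have hl : left q (M, X, Z) = (M, delete X z, delete Z' z) := by
    simp [left, hsplit, hpz, hp]
  have hr : right q (M, X, Z) = (M, far M X [z], far M Z' [z]) := by
    simp [right, hsplit, hpz, hp]
  have hmem : ∀ u ∈ b, u ∈ X ∧ z ≠ u ∧ ¬ G.Adj z u := fun u hu => by
    have := (mem_far hM).1 (hb hu)
    simpa using this
  have haX : a ⊆ X := fun u hu => (mem_delete.1 (ha hu)).1
  have hmerge : merge q ((M, X, Z), a, b) = if b.length < a.length then a else z :: b := by
    simp [merge, hsplit, hpz]
  have hb' : indepList M (z :: b) = true := by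
    simp only [indepList, hbI, Bool.and_true, List.all_eq_true, Bool.and_eq_true,
      Bool.not_eq_true', beq_eq_false_iff_ne, hM.adj_eq_false]
    exact fun u hu => (hmem u hu).2
  have hsub : merge q ((M, X, Z), a, b) ⊆ X := by
    rw [hmerge]
    split_ifs
    · exact haX
    · exact List.cons_subset.2 ⟨hzX, fun u hu => (hmem u hu).1⟩
  have hind : indepList M (merge q ((M, X, Z), a, b)) = true := by
    rw [hmerge]
    split_ifs
    · exact haI
    · exact hb'
  refine ⟨_, m + n, .node hleaf (sz_state_le hX hZ) hsa hsb (hl ▸ hta) (hr ▸ htb), hsub, hind,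
    ?_, ?_, Nat.add_le_add hm hn⟩
  · have := (hX.subset (nodup_of_indepList hind) hsub).sz_le
    unfold stateBound; omega
  · intro A hA hAX
    have hlen : a.length ≤ (merge q ((M, X, Z), a, b)).length ∧
        b.length + 1 ≤ (merge q ((M, X, Z), a, b)).length := by
      rw [hmerge]
      split_ifs with h
      · omega
      · rw [List.length_cons]; omega
    by_cases hzA : z ∈ A
    · have := hAb (A.erase z) (hA.mono (Finset.erase_subset _ _)) fun u hu => by
        rw [Finset.mem_erase] at hu
        rw [List.mem_toFinset, mem_far hM]
        refine ⟨by simpa using hAX hu.2, fun w hw => ?_⟩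
        obtain rfl := List.mem_singleton.1 hw
        exact ⟨hu.1.symm, hA w hzA u hu.2⟩
      rw [Finset.card_erase_of_mem hzA] at this
      have := Nat.mul_le_mul_left d hlen.2
      rw [mul_add] at this
      omega
    · refine (hAa A hA fun u hu => ?_).trans (Nat.mul_le_mul_left d hlen.1)
      rw [List.mem_toFinset, mem_delete]
      exact ⟨by simpa using hAX hu, fun h => hzA (h ▸ hu)⟩

/-- No edge leaves a component, so the union of the two solutions is independent and the two
estimates add up. -/
theorem solves_split (hM : Represents M G) (hX : Valid M X)
    (hsplit : isSplit (M, X, []) = true) {x : ℕ} (hx : x ∈ X) (hxX : X.headD 0 = x) {B₁ B₂ : ℕ}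
    (h₁ : Solves M G d q (stateBound M) (component M X x) [] B₁)
    (h₂ : Solves M G d q (stateBound M) (X.filter fun u => !(mem (component M X x) u)) [] B₂) :
    Solves M G d q (stateBound M) X [] (B₁ + B₂) := by
  obtain ⟨a, m, hta, ha, haI, hsa, hAa, hm⟩ := h₁
  obtain ⟨b, n, htb, hb, hbI, hsb, hAb, hn⟩ := h₂
  have hfc : firstComponent (M, X, []) = component M X x := by
    simp only [firstComponent, hxX]
  have hleaf : isLeaf q (M, X, []) = false := by simp [isLeaf, hsplit]
  have hl : left q (M, X, []) = (M, component M X x, []) := by simp [left, hsplit, hfc]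
  have hr : right q (M, X, []) = (M, X.filter fun u => !(mem (component M X x) u), []) := by
    simp [right, hsplit, hfc]
  have hmerge : merge q ((M, X, []), a, b) = a ++ b := by simp [merge, hsplit]
  have hbmem : ∀ u ∈ b, u ∈ X ∧ u ∉ component M X x := fun u hu => by
    have := List.mem_filter.1 (hb hu)
    simpa [← mem_eq_true] using this
  have hcl := closedIn_component hM hX.1 hx
  have hsub : a ++ b ⊆ X := List.append_subset.2
    ⟨fun u hu => component_subset hx (ha hu), fun u hu => (hbmem u hu).1⟩
  have haI' := (indepList_eq_true hM).1 haI
  have hbI' := (indepList_eq_true hM).1 hbI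
  have hcross : ∀ u ∈ a, ∀ w ∈ b, ¬ G.Adj u w := fun u hu w hw huw =>
    (hbmem w hw).2 (by
      simpa using hcl u (by simpa using ha hu) w (by simpa using (hbmem w hw).1) huw)
  have hind : indepList M (a ++ b) = true := by
    rw [indepList_eq_true hM]
    refine ⟨List.nodup_append'.2 ⟨haI'.1, hbI'.1, fun u hu hu' => (hbmem u hu').2 (ha hu)⟩, ?_⟩
    intro u hu w hw
    rw [List.mem_toFinset, List.mem_append] at hu hw
    rcases hu with hu | hu <;> rcases hw with hw | hw
    · exact haI'.2 u (by simpa using hu) w (by simpa using hw)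
    · exact hcross u hu w hw
    · exact fun h => hcross w hw u hu h.symm
    · exact hbI'.2 u (by simpa using hu) w (by simpa using hw)
  have htree : RecTree (isLeaf q) base (left q) (right q) (merge q) (stateBound M) (M, X, [])
      (merge q ((M, X, []), a, b)) (m + n) :=
    .node hleaf (sz_state_le hX ⟨List.nodup_nil, by simp⟩) hsa hsb (hl ▸ hta) (hr ▸ htb)
  rw [hmerge] at htree
  refine ⟨_, m + n, htree, hsub, hind, ?_, ?_, Nat.add_le_add hm hn⟩
  · have := (hX.subset (nodup_of_indepList hind) hsub).sz_le
    unfold stateBound; omega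
  · intro A hA hAX
    have h₁ := hAa (A ∩ (component M X x).toFinset) (hA.mono Finset.inter_subset_left)
      Finset.inter_subset_right
    have h₂ := hAb (A \ (component M X x).toFinset) (hA.mono Finset.sdiff_subset) fun u hu => by
      rw [Finset.mem_sdiff, List.mem_toFinset] at hu
      have huX : u ∈ X := by simpa using hAX hu.1
      rw [List.mem_toFinset, List.mem_filter]
      refine ⟨huX, ?_⟩
      rw [Bool.not_eq_true', ← Bool.not_eq_true, mem_eq_true]
      exact hu.2
    have h₃ := Finset.card_inter_add_card_sdiff A (component M X x).toFinset
    rw [List.length_append, mul_add]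
    omega

end IndepSearch

/-! ### The main induction on the number of vertices -/

namespace IndepSearch

open TreeLang

variable {M : Mat} {G : SimpleGraph ℕ} {d q : ℕ} {X Z : List ℕ}

theorem headD_mem {X : List ℕ} (hX : X ≠ []) : X.headD 0 ∈ X := by
  cases X with
  | nil => exact absurd rfl hX
  | cons => simp

theorem connectedOn_of_isSplit_eq_false (hM : Represents M G) (hX : X.Nodup)
    (hsplit : isSplit (M, X, []) = false) : G.ConnectedOn X.toFinset := by
  rcases eq_or_ne X [] with rfl | hne
  · intro A hA hne
    exact absurd (Finset.subset_empty.1 hA) hne.ne_empty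
  have hx := headD_mem hne
  have hC := isComponent_component hM hX hx
  simp only [isSplit, firstComponent, List.isEmpty_nil, Bool.true_and] at hsplit
  replace hsplit := not_lt.1 (of_decide_eq_false hsplit)
  have : (component M X (X.headD 0)).toFinset = X.toFinset := by
    refine Finset.eq_of_subset_of_card_le hC.subset ?_
    rwa [List.toFinset_card_of_nodup hX, List.toFinset_card_of_nodup (nodup_component hX _)]
  rw [← this]
  exact hC.connected

theorem length_delete_lt {v : ℕ} (hv : v ∈ X) : (delete X v).length < X.length :=
  List.length_filter_lt_length_iff_exists.2 ⟨v, hv, by simp⟩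

theorem length_far_lt {v : ℕ} (hv : v ∈ X) : (far M X [v]).length < X.length :=
  List.length_filter_lt_length_iff_exists.2 ⟨v, hv, by simp⟩

theorem length_far_add_deg (hM : Represents M G) {v : ℕ} (hX : X.Nodup) (hv : v ∈ X) :
    (far M X [v]).length + (deg M X v + 1) ≤ X.length := by
  have hnd : (far M X [v] ++ v :: X.filter fun u => adj M v u).Nodup := by
    refine List.nodup_append'.2 ⟨hX.filter _, List.nodup_cons.2 ⟨?_, hX.filter _⟩, ?_⟩
    · simp [hM _ _]
    · intro u hu hu'
      have h := ((mem_far hM).1 hu).2 v (by simp)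
      rcases List.mem_cons.1 hu' with rfl | hu'
      · exact h.1 rfl
      · exact h.2 ((hM _ _).1 (List.mem_filter.1 hu').2)
  have := (hnd.subperm (l₂ := X) (List.append_subset.2 ⟨List.filter_subset_self X,
    List.cons_subset.2 ⟨hv, List.filter_subset_self X⟩⟩)).length_le
  simpa [deg] using this

theorem length_near_le (hM : Represents M G) {Q : List ℕ} {D : ℕ} (hX : X.Nodup)
    (hdeg : ∀ w ∈ Q, deg M X w ≤ D) : (near M X Q).length ≤ Q.length * (D + 1) := by
  have hnd : (near M X Q).Nodup := hX.filter _
  rw [← List.toFinset_card_of_nodup hnd]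
  have hsub : (near M X Q).toFinset ⊆
      Q.toFinset.biUnion fun w => insert w (X.filter fun u => adj M w u).toFinset := by
    intro u hu
    rw [List.mem_toFinset, mem_near hM] at hu
    obtain ⟨huX, w, hw, hwu⟩ := hu
    refine Finset.mem_biUnion.2 ⟨w, by simpa using hw, ?_⟩
    rcases hwu with rfl | hwu
    · simp
    · simp [huX, (hM w u).2 hwu]
  refine (Finset.card_le_card hsub).trans ((Finset.card_biUnion_le_card_mul _ _ (D + 1)
    fun w hw => ?_).trans (Nat.mul_le_mul_right _ (List.toFinset_card_le _)))
  have := hdeg w (by simpa using hw)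
  exact (Finset.card_insert_le _ _).trans
    (Nat.add_le_add_right ((List.toFinset_card_le _).trans this) 1)

/-- The recursion finds a `d`-approximation; bound for the number of its leaves. -/
theorem solves_of_broom_free {t : ℕ} (hM : Represents M G)
    (hG : ¬ (broom d t).IsIndContained G) (hd : 1 ≤ d) {q Δ K : ℕ} (hq : q = 2 * d + 1 + t)
    (hΔ : Δ = M.length.sqrt + 1) (hK : K = q * Δ) {x : ℕ} :
    ∀ {X Z : List ℕ} {h : ℕ}, X.length = x → Valid M X → Z.Nodup → Z ⊆ X →
      ComponentsLE G (X.toFinset \ Z.toFinset) h →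
      Solves M G d q (stateBound M) X Z (2 ^ Z.length * leafBound Δ K x h) := by
  -- The parameter `h` bounds the components of `X` without the pending vertices `Z`. Thus the gain
  -- from a separator is recorded when it is chosen, and the factor 2^|Z| pays for working through
  -- its neighbourhood.
  induction x using Nat.strong_induction_on with
  | _ x ih =>
  intro X Z h hx hX hZnd hZX hcomp
  have hZ : Valid M Z := hX.subset hZnd hZX
  -- One branching on the head of `Z'`, used both for pending vertices and for a new separator. In
  -- both calls the list gets shorter and `X` without the list does not grow.
  have branch : isSplit (M, X, Z) = false → ∀ {Z' : List ℕ} {h' : ℕ}, pivots q (M, X, Z) = Z' →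
      Z' ≠ [] → Z'.Nodup → Z' ⊆ X → ComponentsLE G (X.toFinset \ Z'.toFinset) h' →
      Solves M G d q (stateBound M) X Z (2 ^ Z'.length * leafBound Δ K x h') := by
    intro hsplit Z' h' hp hne hnd hsub hc
    obtain ⟨z, Zt, rfl⟩ := List.exists_cons_of_ne_nil hne
    have hzZ : z ∈ z :: Zt := by simp
    have hzX : z ∈ X := hsub hzZ
    have step : ∀ {X₁ Z₁ : List ℕ}, X₁.length < X.length → Valid M X₁ → Z₁.Nodup → Z₁ ⊆ X₁ →
        Z₁.length < (z :: Zt).length → X₁.toFinset \ Z₁.toFinset ⊆ X.toFinset \ (z :: Zt).toFinset →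
        Solves M G d q (stateBound M) X₁ Z₁ (2 ^ Zt.length * leafBound Δ K x h') := by
      intro X₁ Z₁ hlt hv hnd₁ hs₁ hl₁ hsd
      obtain ⟨r, m, h₁, h₂, h₃, h₄, h₅, h₆⟩ :=
        ih X₁.length (hx ▸ hlt) rfl hv hnd₁ hs₁ (hc.mono hM hsd)
      refine ⟨r, m, h₁, h₂, h₃, h₄, h₅, h₆.trans (Nat.mul_le_mul ?_ ?_)⟩
      · rw [List.length_cons] at hl₁
        exact Nat.pow_le_pow_right (by omega) (by omega)
      · exact leafBound_mono (by omega) le_rfl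
    have := solves_pivot hM hd hX hZ hsplit hp (z := z) rfl hzX
      (step (length_delete_lt hzX) (hX.filter _) (hnd.filter _) (fun u hu => by
          rw [mem_delete] at hu ⊢
          exact ⟨hsub hu.1, hu.2⟩) (length_delete_lt hzZ) (fun u hu => by
          simp only [Finset.mem_sdiff, List.mem_toFinset, mem_delete] at hu ⊢
          exact ⟨hu.1.1, fun hu' => hu.2 ⟨hu', hu.1.2⟩⟩))
      (step (length_far_lt hzX) (hX.filter _) (hnd.filter _) (fun u hu => by
          rw [mem_far hM] at hu ⊢
          exact ⟨hsub hu.1, hu.2⟩) (length_far_lt hzZ) (fun u hu => by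
          simp only [Finset.mem_sdiff, List.mem_toFinset, mem_far hM] at hu ⊢
          exact ⟨hu.1.1, fun hu' => hu.2 ⟨hu', hu.1.2⟩⟩))
    rwa [← two_mul, ← mul_assoc, ← pow_succ'] at this
  by_cases hZe : Z = []
  swap
  · refine branch ?_ ?_ hZe hZnd hZX hcomp
    · simp [isSplit, hZe]
    · simp [pivots, hZe]
  subst hZe
  rw [List.toFinset_nil, Finset.sdiff_empty] at hcomp
  rw [List.length_nil, pow_zero, one_mul]
  cases hsplit : isSplit (M, X, []) with
  | true =>
    have hlt : (component M X (X.headD 0)).length < X.length := by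
      simpa [isSplit, firstComponent] using hsplit
    have hne : X ≠ [] := by rintro rfl; simp at hlt
    have hxX := headD_mem hne
    set C := component M X (X.headD 0) with hC
    set D := X.filter fun u => !(mem C u) with hD
    have hCX : C ⊆ X := component_subset hxX
    have hCnd : C.Nodup := nodup_component hX.1 _
    have hmemD : ∀ u, u ∈ D ↔ u ∈ X ∧ u ∉ C := fun u => by
      rw [hD, List.mem_filter, Bool.not_eq_true', ← Bool.not_eq_true, mem_eq_true]
    have hDnd : D.Nodup := hX.1.filter _
    have hsum : C.length + D.length = X.length := by
      have h₁ : D.toFinset = X.toFinset \ C.toFinset := by ext u; simp [hmemD]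
      have h₂ := Finset.card_sdiff_add_card_eq_card (toFinset_subset_toFinset hCX)
      rw [← h₁, List.toFinset_card_of_nodup hCnd, List.toFinset_card_of_nodup hX.1,
        List.toFinset_card_of_nodup hDnd] at h₂
      omega
    have hCpos : 1 ≤ C.length := List.length_pos_of_mem (mem_component_self hM hxX)
    have hDX : D ⊆ X := List.filter_subset_self X
    have h₁ := ih C.length (by omega) rfl (hX.subset hCnd hCX) List.nodup_nil (by simp)
      (by simpa using hcomp.mono hM (toFinset_subset_toFinset hCX))
    have h₂ := ih D.length (by omega) rfl (hX.filter _) List.nodup_nil (by simp)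
      (by simpa using hcomp.mono hM (toFinset_subset_toFinset hDX))
    obtain ⟨r, m, k₁, k₂, k₃, k₄, k₅, k₆⟩ := solves_split hM hX hsplit hxX rfl h₁ h₂
    refine ⟨r, m, k₁, k₂, k₃, k₄, k₅, k₆.trans ?_⟩
    have := leafBound_add (Δ := Δ) (K := K) (h := h) hCpos (b := D.length) (by omega)
    rw [hsum, hx] at this
    simpa using this
  | false =>
    have hconn := connectedOn_of_isSplit_eq_false hM hX.1 hsplit
    by_cases hheavy : heavy (M, X, []) = []
    swap
    · have hv := headD_mem hheavy
      set v := (heavy (M, X, [])).headD 0 with hvdef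
      simp only [heavy, List.mem_filter, decide_eq_true_eq] at hv
      obtain ⟨hvX, hdeg⟩ := hv
      rw [← Nat.sqrt_lt] at hdeg
      have hlen := length_far_add_deg hM hX.1 hvX
      have hp : pivots q (M, X, []) = [v] := by simp [pivots, hheavy, hvdef]
      have hdel : delete [v] v = [] := by simp [delete]
      have hfar : far M [v] [v] = [] := by simp [far]
      have hdX : delete X v ⊆ X := List.filter_subset_self X
      have hfX : far M X [v] ⊆ X := List.filter_subset_self X
      have hlt := length_delete_lt hvX
      have h₁ := ih (delete X v).length (by omega) rfl (hX.filter _) List.nodup_nil (by simp)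
        (by simpa using hcomp.mono hM (toFinset_subset_toFinset hdX))
      have h₂ := ih (far M X [v]).length (by omega) rfl (hX.filter _) List.nodup_nil (by simp)
        (by simpa using hcomp.mono hM (toFinset_subset_toFinset hfX))
      obtain ⟨r, m, k₁, k₂, k₃, k₄, k₅, k₆⟩ := solves_pivot hM hd hX hZ hsplit hp (z := v) rfl hvX
        (by rw [hdel]; exact h₁) (by rw [hfar]; exact h₂)
      refine ⟨r, m, k₁, k₂, k₃, k₄, k₅, k₆.trans ?_⟩
      -- The degree exceeds √n, so it is at least Δ, and taking `v` removes at least Δ vertices.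
      have h₃ := leafBound_branch (K := K) (h := h) (Δ := Δ) (x := x)
        (y := (far M X [v]).length) (by omega) (by omega)
      have h₄ := leafBound_mono (Δ := Δ) (K := K) (x := (delete X v).length) (y := x - 1)
        (by omega) (le_refl h)
      simp only [List.length_nil, pow_zero, one_mul]
      omega
    · by_cases hsep : separators q (M, X, []) = []
      · have hleaf : isLeaf q (M, X, []) = true := by
          simp [isLeaf, hsplit, pivots, hheavy, hsep]
        -- A star with 2d leaves would give a separator of at most `q` vertices, hence a separating
        -- `q`-tuple, but all tuples have been tried.
        have hstar : G.StarFreeOn (2 * d) X.toFinset := by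
          by_contra hstar
          obtain ⟨Q, hQX, hQ, hQc, hQs⟩ := SimpleGraph.exists_separator hG hconn hstar
          obtain ⟨T, hT, rfl⟩ := exists_tuple hQ hQX (hq ▸ hQc)
          have : T ∈ separators q (M, X, []) := by
            refine List.mem_filter.2 ⟨hT, (isSep_eq_true hM hX.1 T).2 fun C hC => ?_⟩
            rw [← List.toFinset_card_of_nodup hX.1]
            exact hQs C hC
          rw [hsep] at this
          simp at this
        obtain ⟨r, m, k₁, k₂, k₃, k₄, k₅, k₆⟩ := solves_leaf hM hd hX hZ hleaf hstar
        exact ⟨r, m, k₁, k₂, k₃, k₄, k₅, k₆.trans (leafBound_pos _ _ _ _)⟩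
      · have hT : (separators q (M, X, [])).headD [] ∈ separators q (M, X, []) := by
          cases hs : separators q (M, X, []) with
          | nil => exact absurd hs hsep
          | cons => simp
        set T := (separators q (M, X, [])).headD [] with hTdef
        obtain ⟨hT₁, hT₂⟩ := List.mem_filter.1 hT
        obtain ⟨hTq, hTX⟩ := mem_tuples.1 hT₁
        have hT₃ := (isSep_eq_true hM hX.1 T).1 hT₂
        have hp : pivots q (M, X, []) = near M X T := by simp [pivots, hheavy, hsep, hTdef]
        obtain ⟨a, ha⟩ : ∃ a, a ∈ T := List.exists_mem_of_length_pos (by omega)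
        have haX : a ∈ X := hTX a ha
        have hxpos : 0 < x := hx ▸ List.length_pos_of_mem haX
        have hnear : a ∈ near M X T := (mem_near hM).2 ⟨haX, a, ha, .inl rfl⟩
        have hlow : ∀ w ∈ T, deg M X w ≤ M.length.sqrt := by
          intro w hw
          have : w ∉ heavy (M, X, []) := by rw [hheavy]; simp
          simp only [heavy, List.mem_filter, decide_eq_true_eq, not_and, not_lt] at this
          exact Nat.le_sqrt.2 (this (hTX w hw))
        have hcard : (near M X T).length ≤ K := by
          have := length_near_le hM hX.1 hlow
          rwa [hTq, ← hΔ, ← hK] at this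
        -- The largest `h` with 2h < x, for positive `x`, is (x-1)/2.
        have hcomp' : ComponentsLE G (X.toFinset \ (near M X T).toFinset) ((x - 1) / 2) := by
          intro C hC
          have heq : X.toFinset \ (near M X T).toFinset = G.away X.toFinset T.toFinset := by
            ext u
            simp only [Finset.mem_sdiff, List.mem_toFinset, mem_near hM, SimpleGraph.mem_away]
            constructor
            · rintro ⟨h₁, h₂⟩
              refine ⟨h₁, fun w hw => ⟨fun h => h₂ ⟨h₁, w, hw, .inl h⟩,
                fun h => h₂ ⟨h₁, w, hw, .inr h⟩⟩⟩
            · rintro ⟨h₁, h₂⟩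
              refine ⟨h₁, ?_⟩
              rintro ⟨-, w, hw, h | h⟩
              · exact (h₂ w hw).1 h
              · exact (h₂ w hw).2 h
          rw [heq] at hC
          have := hT₃ C hC
          omega
        obtain ⟨r, m, k₁, k₂, k₃, k₄, k₅, k₆⟩ := branch hsplit hp
          (List.ne_nil_of_mem hnear) (hX.1.filter _) (List.filter_subset_self X) hcomp'
        refine ⟨r, m, k₁, k₂, k₃, k₄, k₅, k₆.trans ?_⟩
        -- The separator gives a bound in terms of `x` alone. As `X` is connected it is its own
        -- component, so x ≤ h.
        refine (leafBound_separator hcard (by omega)).trans (leafBound_mono le_rfl ?_)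
        have := hcomp X.toFinset ⟨Finset.Subset.refl _, ⟨a, by simpa using haX⟩, hconn,
          fun _ _ y hy _ => hy⟩
        rwa [List.toFinset_card_of_nodup hX.1, hx] at this

end IndepSearch

/-! ### The program -/

namespace IndepSearch

open TreeLang

/-- The program of the algorithm. Its number of steps is the number of leaves of the recursion
tree, up to a polynomial factor. -/
theorem exists_program (q : ℕ) : ∃ (P : Program) (c : ℕ), ∀ (M : Mat) (r : List ℕ) (m : ℕ),
    RecTree (isLeaf q) base (left q) (right q) (merge q) (stateBound M) (start M) r m →
    sz r ≤ stateBound M →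
    ∃ k ≤ m * (stateBound M + 2) ^ c, Runs P (Enc.enc M) (Enc.enc (charVec M r)) k := by
  obtain ⟨P₁, e₁, c₁, h₁⟩ := RecTree.exists_eval (polyTime_isLeaf q) polyTime_base
    (polyTime_left q) (polyTime_right q) (polyTime_merge q)
  obtain ⟨-, P₂, e₂, T₂, ⟨c₂, hT₂⟩, h₂⟩ := polyTime_start
  obtain ⟨-, P₃, e₃, T₃, ⟨c₃, hT₃⟩, h₃⟩ := polyTime_charVec
  obtain ⟨R', σ', l₁', l₂'⟩ := exists_link P₂ P₃
  obtain ⟨R, σ, l₁, l₂⟩ := exists_link P₁ R'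
  -- The input is kept next to the result of the recursion, since the characteristic vector needs
  -- the number of vertices.
  let e : Expr := .letIn (.cons (.var 0) (.letIn (σ e₂) e₁)) (σ (σ' e₃))
  have hpoly : PolyBdd fun n : ℕ => (n + 2) ^ c₁ + (n + 2) ^ c₂ + (2 * n + 3) ^ c₃ + 10 := by
    have hs : PolyBdd fun n : ℕ => n + 2 := (PolyBdd.size (α := ℕ)).add (.const 1) |>.mono
      fun n => by rw [sz_nat]; omega
    have hs' : PolyBdd fun n : ℕ => 2 * n + 3 := (hs.mul (.const 2)).mono fun n => by omega
    exact (((hs.pow _).add (hs.pow _)).add (hs'.pow _)).add (.const 10)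
  obtain ⟨c, hc⟩ := hpoly
  -- The main function must have index 0, so all others are moved up by one.
  refine ⟨[e.shift 1] ++ R.map (Expr.shift 1), 2 * c, fun M r m htree hr => ?_⟩
  have hm := htree.one_le
  obtain ⟨k₁, hk₁, hev₁⟩ := h₁ _ _ _ _ htree
  obtain ⟨k₂, hk₂, hev₂⟩ := h₂ M
  obtain ⟨k₃, hk₃, hev₃⟩ := h₃ (M, r)
  have hev : Eval R [Enc.enc M] e (Enc.enc (charVec M r)) (1 + (k₂ + k₁ + 1) + 1 + k₃ + 1) :=
    .letIn (.cons (.var rfl) (.letIn (l₂ (l₁' hev₂)) ((l₁ hev₁).cons_env _)))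
      ((l₂ (l₂' hev₃)).cons_env _)
  refine ⟨_, ?_, .call (.var rfl) rfl (hev.shift [e.shift 1])⟩
  set S := stateBound M
  have hMS : sz M ≤ S := by simp only [S, stateBound]; omega
  have hrS : sz (M, r) ≤ 2 * S + 1 := by rw [sz_prod]; omega
  have b₂ : k₂ ≤ (S + 2) ^ c₂ :=
    hk₂.trans ((hT₂ M).trans (Nat.pow_le_pow_left (by omega) _))
  have b₃ : k₃ ≤ (2 * S + 3) ^ c₃ :=
    hk₃.trans ((hT₃ (M, r)).trans (Nat.pow_le_pow_left (by omega) _))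
  have hcS : (S + 2) ^ c₁ + (S + 2) ^ c₂ + (2 * S + 3) ^ c₃ + 10 ≤ (S + 2) ^ (2 * c) := by
    refine (hc S).trans ?_
    rw [pow_mul]
    refine Nat.pow_le_pow_left ?_ _
    rw [sz_nat]; nlinarith
  calc 1 + (1 + (k₂ + k₁ + 1) + 1 + k₃ + 1) + 1
      ≤ m * (S + 2) ^ c₁ + 1 * ((S + 2) ^ c₂ + (2 * S + 3) ^ c₃ + 10) := by omega
    _ ≤ m * (S + 2) ^ c₁ + m * ((S + 2) ^ c₂ + (2 * S + 3) ^ c₃ + 10) := by gcongr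
    _ = m * ((S + 2) ^ c₁ + (S + 2) ^ c₂ + (2 * S + 3) ^ c₃ + 10) := by ring
    _ ≤ _ := Nat.mul_le_mul_left _ hcS

/-! ### Adjacency matrices -/

open Classical in
/-- The adjacency matrix of a graph. -/
noncomputable def matrix {n : ℕ} (G : SimpleGraph (Fin n)) : Mat :=
  (List.finRange n).map fun i => (List.finRange n).map fun j => decide (G.Adj i j)

variable {n : ℕ} (G : SimpleGraph (Fin n))

theorem length_matrix : (matrix G).length = n := by simp [matrix]

theorem encodeGraph_eq : encodeGraph G = Enc.enc (matrix G) := by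
  simp [encodeGraph, matrix, Enc.enc, Function.comp_def]

/-- The algorithm works on graphs on ℕ; all numbers from `n` on are isolated there, matching the
default values of `getD`. -/
theorem represents_matrix : Represents (matrix G) (G.map Fin.valEmbedding) := by
  intro i j
  rw [SimpleGraph.map_adj]
  simp only [adj, matrix, ← List.ofFn_eq_map, List.getD_eq_getElem?_getD, List.getElem?_ofFn]
  constructor
  · intro h
    by_cases hi : i < n
    · by_cases hj : j < n
      · simp only [hi, hj, dite_true, Option.getD_some, List.getElem?_ofFn, decide_eq_true_eq] at h
        exact ⟨⟨i, hi⟩, ⟨j, hj⟩, h, rfl, rfl⟩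
      · simp [hi, hj] at h
    · simp [hi] at h
  · rintro ⟨u, v, huv, rfl, rfl⟩
    simpa using huv

theorem stateBound_matrix_le : stateBound (matrix G) + 2 ≤ (n + 2) ^ 4 := by
  have hsz : sz (matrix G) ≤ 1 + n * (1 + n * (3 + 1) + 1) := by
    have := sz_le_of_forall (l := matrix G) (s := 1 + n * (3 + 1)) fun row hrow => by
      obtain ⟨i, -, rfl⟩ := List.mem_map.1 hrow
      refine (sz_le_of_forall (s := 3) fun b _ => sz_bool b).trans ?_
      simp
    rwa [length_matrix] at this
  unfold stateBound listBound
  rw [length_matrix]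
  nlinarith [sq_nonneg n, pow_pos (Nat.succ_pos n) 3, pow_pos (Nat.succ_pos n) 4]

/-- For t ≥ 2 every vertex of the broom has a neighbour, so an induced copy avoids the isolated
numbers outside the image of `Fin n`. -/
theorem broom_isIndContained_of_map {d t : ℕ} (ht : 2 ≤ t)
    (h : (broom d t).IsIndContained (G.map Fin.valEmbedding)) : (broom d t).IsIndContained G := by
  obtain ⟨φ⟩ := h
  have hnbr : ∀ a, ∃ b, (broom d t).Adj a b := by
    rintro (i | i)
    · by_cases hi : i.val = 0
      · refine ⟨.inl ⟨1, by omega⟩, ?_⟩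
        exact SimpleGraph.pathGraph_adj.2 (.inl (by simp [hi]))
      · refine ⟨.inl ⟨i.val - 1, by omega⟩, ?_⟩
        exact SimpleGraph.pathGraph_adj.2 (.inr (by simp; omega))
    · exact ⟨.inl ⟨0, by omega⟩, rfl⟩
  have hex : ∀ a, ∃ u : Fin n, Fin.valEmbedding u = φ a := by
    intro a
    obtain ⟨b, hab⟩ := hnbr a
    obtain ⟨u, -, -, hu, -⟩ := (SimpleGraph.map_adj _ _ _ _).1 (φ.map_rel_iff.2 hab)
    exact ⟨u, hu⟩
  choose f hf using hex
  refine ⟨⟨⟨f, fun a b hab => φ.injective ?_⟩, fun {a b} => ?_⟩⟩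
  · rw [← hf a, ← hf b, hab]
  · change G.Adj (f a) (f b) ↔ _
    rw [← φ.map_rel_iff (a := a) (b := b), ← hf a, ← hf b]
    exact SimpleGraph.map_adj_apply.symm

theorem encodeSet_eq (r : List ℕ) :
    encodeSet (Finset.univ.filter fun i : Fin n => i.val ∈ r) =
      Enc.enc (charVec (matrix G) r) := by
  unfold charVec
  rw [length_matrix, ← List.map_coe_finRange_eq_range, List.map_map]
  simp only [encodeSet, Enc.enc, List.map_map]
  congr 1
  refine List.map_congr_left fun i _ => ?_
  simp [mem_eq_true]

/-! ### The running time -/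

theorem leafBound_le (n q : ℕ) :
    leafBound (n.sqrt + 1) (q * (n.sqrt + 1)) n n ≤
      (n + 2) ^ (1 + n.sqrt + q * (n.sqrt + 1)) := by
  have hdiv : n / (n.sqrt + 1) ≤ n.sqrt := by
    rw [← Nat.lt_succ_iff, Nat.div_lt_iff_lt_mul (by omega)]
    exact Nat.lt_succ_sqrt n
  unfold leafBound
  rw [pow_add, pow_add, pow_one]
  gcongr ?_ * ?_ * ?_
  · omega
  · exact (Nat.pow_le_pow_left (by omega) _).trans (Nat.pow_le_pow_right (by omega) hdiv)
  · exact Nat.pow_le_pow_left (by omega) _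

/-- For n ≥ 2 one has n+2 ≤ n² and 1 ≤ ⌊√n⌋, so the exponent becomes a multiple of ⌊√n⌋, which is
then weakened to n^{3/4}. The parameter `a` leaves room for the polynomial cost per leaf. -/
theorem pow_sqrt_le (n a q : ℕ) (hn : 2 ≤ n) :
    (((n + 2) ^ (a + (1 + n.sqrt + q * (n.sqrt + 1))) : ℕ) : ℝ) ≤
      2 ^ ((2 * a + 4 + 4 * q : ℕ) * (n : ℝ) ^ (3 / 4 : ℝ) * Real.logb 2 n) := by
  have hs : 1 ≤ n.sqrt := Nat.le_sqrt.2 (by omega)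
  have hexp : 2 * (a + (1 + n.sqrt + q * (n.sqrt + 1))) ≤ (2 * a + 4 + 4 * q) * n.sqrt := by
    nlinarith [Nat.mul_le_mul_left a hs, Nat.mul_le_mul_left q hs]
  have hnat : (n + 2) ^ (a + (1 + n.sqrt + q * (n.sqrt + 1))) ≤
      n ^ ((2 * a + 4 + 4 * q) * n.sqrt) := by
    calc (n + 2) ^ (a + (1 + n.sqrt + q * (n.sqrt + 1)))
        ≤ (n ^ 2) ^ (a + (1 + n.sqrt + q * (n.sqrt + 1))) :=
          Nat.pow_le_pow_left (by nlinarith) _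
      _ = n ^ (2 * (a + (1 + n.sqrt + q * (n.sqrt + 1)))) := by rw [← pow_mul]
      _ ≤ _ := Nat.pow_le_pow_right (by omega) hexp
  have hn0 : (0 : ℝ) < n := by positivity
  have hn1 : (1 : ℝ) ≤ n := by exact_mod_cast (by omega : 1 ≤ n)
  have hlog : 0 ≤ Real.logb 2 n := Real.logb_nonneg (by norm_num) hn1
  have hsqrt : (n.sqrt : ℝ) ≤ (n : ℝ) ^ (3 / 4 : ℝ) := by
    calc (n.sqrt : ℝ) ≤ √(n : ℝ) := Real.nat_sqrt_le_real_sqrt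
      _ = (n : ℝ) ^ (1 / 2 : ℝ) := Real.sqrt_eq_rpow _
      _ ≤ _ := Real.rpow_le_rpow_of_exponent_le hn1 (by norm_num)
  calc (((n + 2) ^ (a + (1 + n.sqrt + q * (n.sqrt + 1))) : ℕ) : ℝ)
      ≤ ((n ^ ((2 * a + 4 + 4 * q) * n.sqrt) : ℕ) : ℝ) := by exact_mod_cast hnat
    _ = ((2 : ℝ) ^ Real.logb 2 n) ^ ((((2 * a + 4 + 4 * q) * n.sqrt : ℕ)) : ℝ) := by
        rw [Real.rpow_logb (by norm_num) (by norm_num) hn0, Real.rpow_natCast, Nat.cast_pow]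
    _ = 2 ^ ((2 * a + 4 + 4 * q : ℕ) * (n.sqrt : ℝ) * Real.logb 2 n) := by
        rw [← Real.rpow_mul (by norm_num)]
        congr 1
        push_cast
        ring
    _ ≤ _ := by
        refine Real.rpow_le_rpow_of_exponent_le (by norm_num) ?_
        gcongr

end IndepSearch

/-! ### The theorem for graphs on `Fin n` -/

open IndepSearch TreeLang

theorem theorem2 (d t : ℕ) (hd : 2 ≤ d) (ht : 2 ≤ t) :
    ∃ (P : TreeLang.Program) (C : ℝ),
      ∀ (n : ℕ) (G : SimpleGraph (Fin n)), ¬ (broom d t).IsIndContained G →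
        ∃ (I : Finset (Fin n)) (k : ℕ),
          TreeLang.Runs P (TreeLang.encodeGraph G) (TreeLang.encodeSet I) k ∧
          G.IsIndepSet (I : Set (Fin n)) ∧
          G.indepNum ≤ d * I.card ∧
          (2 ≤ n → (k : ℝ) ≤ 2 ^ (C * (n : ℝ) ^ (3 / 4 : ℝ) * Real.logb 2 n)) := by
  obtain ⟨P, c, hP⟩ := exists_program (2 * d + 1 + t)
  -- The constant of `pow_sqrt_le` with a = 4c: the cost per leaf is the `c`-th power of a state
  -- bound that is at most (n+2)^4.
  refine ⟨P, ((2 * (4 * c) + 4 + 4 * (2 * d + 1 + t) : ℕ) : ℝ), fun n G hG => ?_⟩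
  have hM := represents_matrix G
  have hlen := length_matrix G
  obtain ⟨r, m, htree, hr, hind, hsz, happrox, hm⟩ :=
    solves_of_broom_free (M := matrix G) (X := List.range n) (Z := []) (h := n) hM
      (fun h => hG (broom_isIndContained_of_map G ht h)) (by omega : 1 ≤ d) rfl rfl rfl
      List.length_range ⟨List.nodup_range, fun a ha => by rw [hlen]; exact List.mem_range.1 ha⟩
      List.nodup_nil (List.nil_subset _)
      (componentsLE_length _ _ Finset.sdiff_subset List.length_range.le)
  rw [List.length_nil, pow_zero, one_mul, hlen] at hm
  have hstart : start (matrix G) = (matrix G, List.range n, []) := by rw [start, hlen]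
  obtain ⟨k, hk, hrun⟩ := hP (matrix G) r m (hstart ▸ htree) hsz
  obtain ⟨hnd, hindep⟩ := (indepList_eq_true hM).1 hind
  refine ⟨Finset.univ.filter fun i : Fin n => i.val ∈ r, k, ?_, ?_, ?_, fun hn => ?_⟩
  · rw [encodeGraph_eq, encodeSet_eq G]
    exact hrun
  · intro a ha b hb _ hab
    simp only [Finset.coe_filter, Finset.mem_univ, true_and, Set.mem_ofPred_eq] at ha hb
    exact hindep a (by simpa using ha) b (by simpa using hb)
      (SimpleGraph.map_adj_apply (f := Fin.valEmbedding).2 hab)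
  · obtain ⟨A, hA⟩ := G.exists_isNIndepSet_indepNum
    have hcard : (Finset.univ.filter fun i : Fin n => i.val ∈ r).card = r.length := by
      rw [← List.toFinset_card_of_nodup hnd, ← Finset.card_map Fin.valEmbedding]
      congr 1
      ext u
      simp only [Finset.mem_map, Finset.mem_filter, Finset.mem_univ, true_and, List.mem_toFinset]
      constructor
      · rintro ⟨i, hi, rfl⟩
        exact hi
      · intro hu
        exact ⟨⟨u, List.mem_range.1 (hr hu)⟩, hu, rfl⟩
    rw [hcard, ← hA.card_eq, ← Finset.card_map Fin.valEmbedding]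
    refine happrox _ ?_ ?_
    · intro a ha b hb hab
      obtain ⟨u, v, huv, rfl, rfl⟩ := (SimpleGraph.map_adj _ _ _ _).1 hab
      rw [Finset.mem_map'] at ha hb
      exact hA.isIndepSet ha hb huv.ne huv
    · intro a ha
      obtain ⟨u, -, rfl⟩ := Finset.mem_map.1 ha
      simp
  · refine le_trans ?_ (pow_sqrt_le n (4 * c) (2 * d + 1 + t) hn)
    have : k ≤ (n + 2) ^ (4 * c + (1 + n.sqrt + (2 * d + 1 + t) * (n.sqrt + 1))) := by
      calc k ≤ m * (stateBound (matrix G) + 2) ^ c := hk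
        _ ≤ (n + 2) ^ (1 + n.sqrt + (2 * d + 1 + t) * (n.sqrt + 1)) * ((n + 2) ^ 4) ^ c := by
          gcongr
          · exact hm.trans (leafBound_le n _)
          · exact stateBound_matrix_le G
        _ = _ := by rw [← pow_mul, ← pow_add, Nat.add_comm (4 * c)]
    exact_mod_cast this
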